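/- Let $1<R<\infty$ and let $h$ be a complex-valued harmonic function on the annulus $A(1,R)=\{z\in\mathbb C: 1<|z|<R\}$ that is $C^1$ up to the inner boundary circle $\mathbb T=\{|z|=1\}$, that is, $h$ extends to a $C^1$ function on $\{1\le |z|<R\}$, still denoted by $h$. Let $f$ be the harmonic extension of $h|_{\mathbb T}$ to the closed unit disk: $f$ is continuous on $\overline{\mathbb D}$, harmonic in $\mathbb D$, and $f=h$ on $\mathbb T$. Then $f$ is $C^1$ on $\overline{\mathbb D}$, and for every $\rho$ with $\sqrt7\le\rho<R$, $$ \begin{aligned} \frac1{2\pi\rho}\int_{\mathbb T_\rho}|h|^2&-\Big(\frac{\rho+\rho^{-1}}2\Big)^2\,\frac1{2\pi}\int_{\mathbb T}\operatorname{Im}(\bar h\,h_\theta)-\frac1\pi\int_{\mathbb T}|h|\,|h|_\rho-\frac{\rho^2-4-\rho^{-2}}{2}\cdot\frac1{2\pi}\int_{\mathbb T}J_h\\ &-\frac{\rho^2-4-\rho^{-2}}{4\pi}\left[\int_{\mathbb T}\det Df-\iint_{\mathbb D}|Df|^2\right]\ \ge\ 0 . \end{aligned} $$ Here $\mathbb T_\rho=\{|z|=\rho\}$,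 integrals over circles are with respect to arc length, and $\iint_{\mathbb D}$ is the integral with respect to area. In polar coordinates, $h_\theta$ is the angular derivative of $h$ and $|h|_\rho$ is the radial derivative of $|h|$ (on $\mathbb T$, the one-sided derivative from outside the disk). Moreover $J_h=\det Dh$ is the Jacobian determinant, and $|Df|^2=|f_x|^2+|f_y|^2$ is the squared Hilbert-Schmidt norm of the differential. On $\mathbb T$ the differentials of $h$ and $f$ are the continuous boundary values from $\{1<|z|<R\}$ and from $\mathbb D$ respectively. -/

import Mathlib

open Real Set Metric MeasureTheory InnerProductSpace

noncomputable section

/-- The open circular annulus `A(r, R) = {z : r < |z| < R}`. -/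
def annulus (r R : ℝ) : Set ℂ := {z | r < ‖z‖ ∧ ‖z‖ < R}

/-- The annulus together with its inner boundary circle, `{z : r ≤ |z| < R}`. -/
def annulusInnerClosed (r R : ℝ) : Set ℂ := {z | r ≤ ‖z‖ ∧ ‖z‖ < R}

/-- The angular derivative `h_θ` at `z = ρ e^{iθ}`. -/
def angularDeriv (h : ℂ → ℂ) (z : ℂ) : ℂ :=
  deriv (fun t : ℝ => h (z * Complex.exp (t * Complex.I))) 0

/-- The radial derivative `|h|_ρ` of the modulus of `h` at `z = ρ e^{iθ}`, taken from the outer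
side of the circle through `z` (at an interior point of a domain where `|h|` is differentiable this
is the usual radial derivative; on the inner boundary circle of an annulus it is the one-sided
derivative). -/
def normRadialDeriv (h : ℂ → ℂ) (z : ℂ) : ℝ :=
  derivWithin (fun r : ℝ => ‖h (r * (z / ‖z‖))‖) (Ici ‖z‖) ‖z‖

/-- The Jacobian determinant at `z ∈ s` of a map `g` which is `C¹` on `s`
(up to those boundary points which belong to `s`). -/
def jacobianWithin (g : ℂ → ℂ) (s : Set ℂ) (z : ℂ) : ℝ :=
  (fderivWithin ℝ g s z).det

/-- The squared Hilbert-Schmidt norm `|Dg|² = |g_x|² + |g_y|²` of the differential matrix. -/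
def hilbertSchmidtSq (g : ℂ → ℂ) (z : ℂ) : ℝ :=
  ‖fderiv ℝ g z 1‖ ^ 2 + ‖fderiv ℝ g z Complex.I‖ ^ 2

/-- `f` is the harmonic extension to the closed unit disk of the restriction of `h` to the unit
circle: continuous on the closed disk, harmonic in the open disk, equal to `h` on the circle. -/
structure IsHarmonicExtension (h f : ℂ → ℂ) : Prop where
  continuousOn : ContinuousOn f (closedBall 0 1)
  harmonic : HarmonicOnNhd f (ball 0 1)
  eqOn : EqOn f h (sphere 0 1)

end

/-! Expand everything in Fourier modes on circles. Let `c n` and `d n` be the coefficients on the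
unit circle of `h` and of its radial derivative, and put K = ρ² - 4 - ρ⁻². By Parseval and its
polarised form, each integral is a sum over `n` of a quadratic expression in `c n` and `d n`, so the
left side splits into independent quadratic forms, one per mode.

The radial profile of a mode needs no differential equation. With E = r∂_r and T = ∂_θ, the function
Ef - iTf = 2z∂_z f is holomorphic, so its n-th coefficient is a multiple of rⁿ; conjugation gives a
multiple of r⁻ⁿ for Ef + iTf (`exists_modeCoeff_eulerDeriv_add`, `exists_modeCoeff_eulerDeriv_sub`).
Solving the two relations gives r^|n| in the disk, a combination of r^|n| and r^(-|n|) in the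
annulus, and a logarithm for n = 0.

C¹ boundary data alone do not make a harmonic extension C¹ up to the circle. Here
`IsHarmonicExtension.exists_reflection` writes f(z) as h(1/z̄) plus d log|z| plus u(z) - u(1/z̄),
where u collects the growing terms of the annulus expansion and is C¹ across the circle. Thus `f`
inherits the one-sided regularity of `h`.

What remains is `mode_contribution_nonneg`. For n ≠ 0 put m = |n|, e = d/m, C = (ρ^m + ρ^(-m))/2 and
S = (ρ^m - ρ^(-m))/2. The form is A|c|² + 2B Re(c̄e) + S²|e|², so B² ≤ AS² suffices. For n = 1 both
A and B vanish, which is what fixes K. Larger m follow from `sq_le_mul_sinh_sq`, and ρ² ≥ 7 enters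
there. -/

/-! ### Fourier coefficients on circles and Parseval. -/

/-- The `n`-th Fourier coefficient of `θ ↦ F (r e^{iθ})`. -/
noncomputable def modeCoeff (F : ℂ → ℂ) (r : ℝ) (n : ℤ) : ℂ :=
  (2 * π)⁻¹ • ∫ θ in (0 : ℝ)..(2 * π),
    Complex.exp (-(n * θ * Complex.I)) * F (circleMap 0 r θ)

theorem modeCoeff_eq_fourierCoeffOn (F : ℂ → ℂ) (r : ℝ) (n : ℤ) :
    modeCoeff F r n = fourierCoeffOn two_pi_pos (fun θ => F (circleMap 0 r θ)) n := by
  rw [fourierCoeffOn_eq_integral, modeCoeff]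
  simp only [sub_zero, one_div]
  congr 1
  refine intervalIntegral.integral_congr fun θ _ => ?_
  simp only [fourier_coe_apply, smul_eq_mul]
  congr 2
  have : (π : ℂ) ≠ 0 := by exact_mod_cast Real.pi_ne_zero
  push_cast
  rw [sub_zero]
  field_simp

theorem continuous_exp_neg_mode (n : ℤ) :
    Continuous fun θ : ℝ => Complex.exp (-(n * θ * Complex.I)) := by
  fun_prop

theorem modeCoeff_congr {F G : ℂ → ℂ} {r : ℝ}
    (h : ∀ θ : ℝ, F (circleMap 0 r θ) = G (circleMap 0 r θ)) (n : ℤ) :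
    modeCoeff F r n = modeCoeff G r n := by
  simp only [modeCoeff, h]

/-- `F` is continuous along the circle of radius `r` about the origin. -/
def ContinuousOnCircle (F : ℂ → ℂ) (r : ℝ) : Prop :=
  Continuous fun θ : ℝ => F (circleMap 0 r θ)

theorem ContinuousOnCircle.of_continuousOn {F : ℂ → ℂ} {s : Set ℂ} {r : ℝ}
    (hF : ContinuousOn F s) (hs : ∀ θ : ℝ, circleMap 0 r θ ∈ s) : ContinuousOnCircle F r :=
  hF.comp_continuous (continuous_circleMap 0 r) hs

theorem modeCoeff_linear {F G : ℂ → ℂ} {r : ℝ} (hF : ContinuousOnCircle F r)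
    (hG : ContinuousOnCircle G r) (a b : ℂ) (n : ℤ) :
    modeCoeff (fun z => a * F z + b * G z) r n = a * modeCoeff F r n + b * modeCoeff G r n := by
  have h1 : IntervalIntegrable (fun θ : ℝ => a * (Complex.exp (-(n * θ * Complex.I))
      * F (circleMap 0 r θ))) volume 0 (2 * π) :=
    (((continuous_exp_neg_mode n).mul hF).const_mul a).intervalIntegrable _ _
  have h2 : IntervalIntegrable (fun θ : ℝ => b * (Complex.exp (-(n * θ * Complex.I))
      * G (circleMap 0 r θ))) volume 0 (2 * π) :=
    (((continuous_exp_neg_mode n).mul hG).const_mul b).intervalIntegrable _ _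
  simp only [modeCoeff, mul_smul_comm]
  rw [← intervalIntegral.integral_const_mul, ← intervalIntegral.integral_const_mul, ← smul_add,
    ← intervalIntegral.integral_add h1 h2]
  congr 1
  refine intervalIntegral.integral_congr fun θ _ => ?_
  ring

theorem modeCoeff_conj (F : ℂ → ℂ) (r : ℝ) (n : ℤ) :
    modeCoeff (fun z => starRingEnd ℂ (F z)) r n = starRingEnd ℂ (modeCoeff F r (-n)) := by
  simp only [modeCoeff, Complex.real_smul, map_mul, Complex.conj_ofReal]
  congr 1
  rw [← intervalIntegral.intervalIntegral_conj]
  refine intervalIntegral.integral_congr fun θ _ => ?_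
  simp only [map_mul, ← Complex.exp_conj]
  congr 2
  simp

theorem norm_modeCoeff_le {F : ℂ → ℂ} {r C : ℝ} (hF : ∀ θ : ℝ, ‖F (circleMap 0 r θ)‖ ≤ C)
    (n : ℤ) : ‖modeCoeff F r n‖ ≤ C := by
  rw [modeCoeff, norm_smul]
  have : ‖∫ θ in (0 : ℝ)..(2 * π), Complex.exp (-(n * θ * Complex.I)) * F (circleMap 0 r θ)‖
      ≤ C * |2 * π - 0| := by
    apply intervalIntegral.norm_integral_le_of_norm_le_const
    intro θ _
    rw [norm_mul]
    have : ‖Complex.exp (-(n * θ * Complex.I))‖ = 1 := by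
      rw [Complex.norm_exp]; simp
    rw [this, one_mul]
    exact hF θ
  rw [sub_zero, abs_of_pos two_pi_pos] at this
  rw [Real.norm_of_nonneg (by positivity), inv_mul_le_iff₀ two_pi_pos]
  linarith

theorem ContinuousOnCircle.exists_norm_modeCoeff_le {F : ℂ → ℂ} {r : ℝ}
    (hF : ContinuousOnCircle F r) : ∃ C, 0 ≤ C ∧ ∀ n, ‖modeCoeff F r n‖ ≤ C := by
  obtain ⟨C, hC⟩ := (isCompact_Icc (a := (0 : ℝ)) (b := 2 * π)).exists_bound_of_continuousOn
    (Continuous.continuousOn hF)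
  have key : ∀ θ : ℝ, ‖F (circleMap 0 r θ)‖ ≤ C := by
    intro θ
    obtain ⟨y, hy, h⟩ := (periodic_circleMap 0 r).exists_mem_Ico₀ two_pi_pos θ
    rw [h]
    exact hC y ⟨hy.1, hy.2.le⟩
  exact ⟨C, (norm_nonneg _).trans (key 0), norm_modeCoeff_le key⟩

theorem hasSum_normSq_modeCoeff {F : ℂ → ℂ} {r : ℝ} (hF : ContinuousOnCircle F r) :
    HasSum (fun n => ‖modeCoeff F r n‖ ^ 2) (circleAverage (fun z => ‖F z‖ ^ 2) 0 r) := by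
  have hm : MemLp (fun θ => F (circleMap 0 r θ)) 2 (volume.restrict (Ioc 0 (2 * π))) := by
    rw [memLp_two_iff_integrable_sq_norm (Continuous.aestronglyMeasurable hF)]
    exact (((Continuous.norm hF).pow 2).integrableOn_Icc (a := 0) (b := 2 * π)).mono_set
      Ioc_subset_Icc_self
  have := hasSum_sq_fourierCoeffOn two_pi_pos hm
  simp only [← modeCoeff_eq_fourierCoeffOn, sub_zero] at this
  exact this

theorem ContinuousOnCircle.linear {F G : ℂ → ℂ} {r : ℝ} (hF : ContinuousOnCircle F r)
    (hG : ContinuousOnCircle G r) (a b : ℂ) :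
    ContinuousOnCircle (fun z => a * F z + b * G z) r :=
  (Continuous.const_mul hF a).add (Continuous.const_mul hG b)

/-- Polarisation of Parseval. Only real parts are needed later, so two of the four polarisation
terms suffice. -/
theorem hasSum_re_conj_mul_modeCoeff {F G : ℂ → ℂ} {r : ℝ} (hF : ContinuousOnCircle F r)
    (hG : ContinuousOnCircle G r) :
    HasSum (fun n => (starRingEnd ℂ (modeCoeff F r n) * modeCoeff G r n).re)
      (circleAverage (fun z => (starRingEnd ℂ (F z) * G z).re) 0 r) := by
  have h1 := hasSum_normSq_modeCoeff (hF.linear hG 1 1)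
  have h2 := hasSum_normSq_modeCoeff (hF.linear hG 1 (-1))
  simp only [modeCoeff_linear hF hG] at h1 h2
  have pol : ∀ a b : ℂ, (starRingEnd ℂ a * b).re
      = (1 / 4) * (‖1 * a + 1 * b‖ ^ 2 - ‖1 * a + (-1) * b‖ ^ 2) := by
    intro a b
    simp only [Complex.sq_norm, Complex.normSq_apply]
    simp
    ring
  have h3 := (h1.sub h2).mul_left (1 / 4)
  simp only [← pol] at h3
  rw [← Real.circleAverage_fun_sub, ← smul_eq_mul, ← Real.circleAverage_fun_smul] at h3
  · simpa only [pol, smul_eq_mul] using h3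
  · exact ((hF.linear hG 1 1).norm.pow 2).intervalIntegrable _ _
  · exact ((hF.linear hG 1 (-1)).norm.pow 2).intervalIntegrable _ _

instance fact_two_pi_pos : Fact (0 < 2 * π) := ⟨two_pi_pos⟩

theorem hasSum_modeCoeff {F : ℂ → ℂ} {r : ℝ} (hF : ContinuousOnCircle F r)
    (hs : Summable (modeCoeff F r)) (θ : ℝ) :
    HasSum (fun n : ℤ => modeCoeff F r n * Complex.exp (n * θ * Complex.I))
      (F (circleMap 0 r θ)) := by
  set g : ℝ → ℂ := fun θ => F (circleMap 0 r θ) with hg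
  have hper : Function.Periodic g (2 * π) := fun x => by
    simp only [hg, (periodic_circleMap 0 r) x]
  let G : C(AddCircle (2 * π), ℂ) := ⟨AddCircle.liftIco (2 * π) 0 g,
    AddCircle.liftIco_continuous (hper 0).symm (Continuous.continuousOn hF)⟩
  have hc : ∀ n, fourierCoeff G n = modeCoeff F r n := by
    intro n
    change fourierCoeff (AddCircle.liftIco (2 * π) 0 g) n = _
    rw [fourierCoeff_liftIco_eq, modeCoeff_eq_fourierCoeffOn]
    congr 1
    simp
  have hs' : Summable (fourierCoeff G) := by
    rwa [show fourierCoeff G = modeCoeff F r from funext hc]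
  -- The lift to the circle is given explicitly only on [0, 2π), so the angle is first moved to that
  -- interval.
  obtain ⟨y', hy', hyθ', hy2⟩ : ∃ y' : ℝ, y' ∈ Ico 0 (2 * π) ∧ g θ = g y' ∧
      ((y' : ℝ) : AddCircle (2 * π)) = (θ : AddCircle (2 * π)) := by
    refine ⟨toIcoMod two_pi_pos 0 θ, by simpa using toIcoMod_mem_Ico two_pi_pos 0 θ, ?_, ?_⟩
    · rw [toIcoMod]; exact (hper.sub_zsmul_eq _).symm
    · rw [toIcoMod, AddCircle.coe_sub, AddCircle.coe_zsmul, AddCircle.coe_period, smul_zero,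
        sub_zero]
  have h := has_pointwise_sum_fourier_series_of_summable hs' (y' : AddCircle (2 * π))
  have hG : G (y' : AddCircle (2 * π)) = g y' := by
    change AddCircle.liftIco (2 * π) 0 g _ = _
    exact AddCircle.liftIco_coe_apply (p := 2 * π) (a := 0) (by simpa using hy')
  rw [hG, ← hyθ', hy2] at h
  convert h using 2 with n
  rw [hc, smul_eq_mul, fourier_coe_apply]
  congr 2
  have : (π : ℂ) ≠ 0 := by exact_mod_cast Real.pi_ne_zero
  push_cast
  field_simp

theorem modeCoeff_of_hasDerivAt {F T : ℂ → ℂ} {r : ℝ} (hT : ContinuousOnCircle T r)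
    (hd : ∀ θ : ℝ, HasDerivAt (fun θ => F (circleMap 0 r θ)) (T (circleMap 0 r θ)) θ) (n : ℤ) :
    modeCoeff T r n = Complex.I * n * modeCoeff F r n := by
  have hper : F (circleMap 0 r (2 * π)) = F (circleMap 0 r 0) := by
    simpa using congrArg F ((periodic_circleMap 0 r) 0)
  have he : ∀ θ : ℝ, HasDerivAt (fun θ : ℝ => Complex.exp (-(n * θ * Complex.I)))
      (-(n * Complex.I) * Complex.exp (-(n * θ * Complex.I))) θ := by
    intro θ
    have h1 : HasDerivAt (fun θ : ℝ => -(n * (θ : ℂ) * Complex.I)) (-(n * Complex.I)) θ := by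
      have := (((Complex.ofRealCLM.hasDerivAt (x := θ)).const_mul (n : ℂ)).mul_const
        Complex.I).neg
      simpa [Pi.neg_def] using this
    simpa [mul_comm] using h1.cexp
  have key := intervalIntegral.integral_mul_deriv_eq_deriv_mul (a := 0) (b := 2 * π)
    (fun x _ => he x) (fun x _ => hd x)
    (by apply Continuous.intervalIntegrable; fun_prop) (Continuous.intervalIntegrable hT _ _)
  simp only [modeCoeff]
  rw [key, hper]
  have e0 : Complex.exp (-(n * ((2 * π : ℝ) : ℂ) * Complex.I)) = 1 := by
    rw [Complex.exp_eq_one_iff]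
    exact ⟨-n, by push_cast; ring⟩
  rw [e0]
  simp only [Complex.ofReal_zero, mul_zero, zero_mul, neg_zero, Complex.exp_zero, sub_self,
    zero_sub, mul_smul_comm, ← intervalIntegral.integral_const_mul,
    ← intervalIntegral.integral_neg]
  congr 1
  refine intervalIntegral.integral_congr fun θ _ => ?_
  ring

theorem continuousOn_modeCoeff {F : ℂ → ℂ} {S : Set ℝ} {s : Set ℂ} (hF : ContinuousOn F s)
    (hS : ∀ r ∈ S, ∀ θ : ℝ, circleMap 0 r θ ∈ s) (n : ℤ) :
    ContinuousOn (fun r => modeCoeff F r n) S := by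
  rw [continuousOn_iff_continuous_domRestrict]
  unfold Set.domRestrict modeCoeff
  refine Continuous.fun_const_smul ?_ _
  apply intervalIntegral.continuous_parametric_intervalIntegral_of_continuous'
    (f := fun (r : S) (θ : ℝ) => Complex.exp (-(n * θ * Complex.I)) * F (circleMap 0 r θ))
  have h1 : Continuous fun p : S × ℝ => circleMap 0 (p.1 : ℝ) p.2 := by
    unfold circleMap; fun_prop
  have h2 : Continuous fun p : S × ℝ => F (circleMap 0 (p.1 : ℝ) p.2) :=
    hF.comp_continuous h1 fun p => hS _ p.1.2 _
  have h3 : Continuous fun p : S × ℝ => Complex.exp (-(n * p.2 * Complex.I)) := by fun_prop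
  exact h3.mul h2

/-! ### Laurent coefficients of holomorphic functions on an annulus. -/

theorem modeCoeff_mul_zpow_eq_circleIntegral {φ : ℂ → ℂ} {r : ℝ} (hr : 0 < r) (n : ℤ) :
    modeCoeff φ r n * (r : ℂ) ^ (-n)
      = (2 * π * Complex.I : ℂ)⁻¹ * ∮ z in C(0, r), (z - 0)⁻¹ • (z ^ (-n) * φ z) := by
  simp only [modeCoeff, circleIntegral, deriv_circleMap, Complex.real_smul]
  have hI : ∀ θ : ℝ, (circleMap 0 r θ * Complex.I) • (circleMap 0 r θ - 0)⁻¹ •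
      (circleMap 0 r θ ^ (-n) * φ (circleMap 0 r θ))
      = (Complex.I * (r : ℂ) ^ (-n)) *
        (Complex.exp (-(n * θ * Complex.I)) * φ (circleMap 0 r θ)) := by
    intro θ
    have h0 : circleMap 0 r θ ≠ 0 := circleMap_ne_center hr.ne'
    have hz : circleMap 0 r θ ^ (-n) = (r : ℂ) ^ (-n) * Complex.exp (-(n * θ * Complex.I)) := by
      simp only [circleMap, zero_add, mul_zpow, ← Complex.exp_int_mul]
      push_cast
      ring_nf
    rw [hz]
    simp only [smul_eq_mul, sub_zero]
    field_simp
  simp only [hI]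
  rw [intervalIntegral.integral_const_mul]
  have : (π : ℂ) ≠ 0 := by exact_mod_cast Real.pi_ne_zero
  push_cast
  rw [mul_assoc, mul_inv]
  generalize (∫ θ : ℝ in (0 : ℝ)..(2 * π),
    Complex.exp (-(n * θ * Complex.I)) * φ (circleMap 0 r θ)) = J
  field_simp

/-- Both sides are the Laurent coefficient of index `n`, a contour integral of z^(-n-1)φ(z), which
by Cauchy does not depend on the radius. -/
theorem modeCoeff_mul_zpow_eq_of_differentiableOn {φ : ℂ → ℂ} {a b r s : ℝ} (ha : 0 ≤ a)
    (hφ : DifferentiableOn ℂ φ (annulus a b)) (har : a < r) (hrs : r ≤ s) (hsb : s < b) (n : ℤ) :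
    modeCoeff φ s n * (s : ℂ) ^ (-n) = modeCoeff φ r n * (r : ℂ) ^ (-n) := by
  have hr : 0 < r := ha.trans_lt har
  rw [modeCoeff_mul_zpow_eq_circleIntegral hr, modeCoeff_mul_zpow_eq_circleIntegral
    (hr.trans_le hrs)]
  congr 1
  have hopen : IsOpen (annulus a b) :=
    (isOpen_lt continuous_const continuous_norm).inter (isOpen_lt continuous_norm continuous_const)
  have hd : ∀ z : ℂ, z ≠ 0 → z ∈ annulus a b →
      DifferentiableAt ℂ (fun z => z ^ (-n) * φ z) z := fun z hz hza =>
    (differentiableAt_zpow.2 (Or.inl hz)).mul (hφ.differentiableAt (hopen.mem_nhds hza))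
  have hmem : ∀ z : ℂ, r ≤ ‖z‖ → ‖z‖ ≤ s → z ≠ 0 ∧ z ∈ annulus a b := fun z h1 h2 =>
    ⟨norm_pos_iff.1 (hr.trans_le h1), har.trans_le h1, h2.trans_lt hsb⟩
  refine Complex.circleIntegral_sub_center_inv_smul_eq_of_differentiable_on_annulus_off_countable
    hr hrs countable_empty (fun z hz => ?_) fun z hz => ?_
  · simp only [mem_sdiff, mem_closedBall, dist_zero_right, mem_ball, not_lt] at hz
    obtain ⟨h1, h2⟩ := hmem z hz.2 hz.1
    exact (hd z h1 h2).continuousAt.continuousWithinAt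
  · simp only [mem_sdiff, mem_closedBall, dist_zero_right, mem_ball, not_le] at hz
    obtain ⟨h1, h2⟩ := hmem z hz.1.2.le hz.1.1.le
    exact hd z h1 h2

theorem isOpen_annulus (a b : ℝ) : IsOpen (annulus a b) :=
  (isOpen_lt continuous_const continuous_norm).inter (isOpen_lt continuous_norm continuous_const)

theorem circleMap_zero_mem_annulus {a b r : ℝ} (ha : 0 ≤ a) (har : a < r) (hrb : r < b) (θ : ℝ) :
    circleMap 0 r θ ∈ annulus a b := by
  have : ‖circleMap 0 r θ‖ = r := by
    rw [norm_circleMap_zero, abs_of_pos (ha.trans_lt har)]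
  exact ⟨by rwa [this], by rwa [this]⟩

/-! ### Radial profile of the modes of a harmonic function. -/

/-- The complex-valued version of `HarmonicAt.differentiableAt_complex_partial`. -/
theorem HarmonicAt.differentiableAt_wirtinger {f : ℂ → ℂ} {x : ℂ} (hf : HarmonicAt f x) :
    DifferentiableAt ℂ (fun z => fderiv ℝ f z 1 - Complex.I * fderiv ℝ f z Complex.I) x := by
  have hre := HarmonicAt.differentiableAt_complex_partial (hf.comp_CLM Complex.reCLM)
  have him := HarmonicAt.differentiableAt_complex_partial (hf.comp_CLM Complex.imCLM)
  have hd : ∀ᶠ z in nhds x, DifferentiableAt ℝ f z :=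
    hf.eventually.mono fun z hz => hz.1.differentiableAt two_ne_zero
  refine (hre.add (him.const_mul Complex.I)).congr_of_eventuallyEq (hd.mono fun z hz => ?_)
  have h1 : fderiv ℝ (⇑Complex.reCLM ∘ f) z = Complex.reCLM.comp (fderiv ℝ f z) :=
    (Complex.reCLM.hasFDerivAt.comp z hz.hasFDerivAt).fderiv
  have h2 : fderiv ℝ (⇑Complex.imCLM ∘ f) z = Complex.imCLM.comp (fderiv ℝ f z) :=
    (Complex.imCLM.hasFDerivAt.comp z hz.hasFDerivAt).fderiv
  apply Complex.ext
  · simp [h1, h2]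
  · simp [h1, h2]
    ring

/-- The Euler derivative `z ↦ Df(z) z`, that is `r ∂f/∂r`. -/
noncomputable def eulerDeriv (f : ℂ → ℂ) (z : ℂ) : ℂ := fderiv ℝ f z z

/-- The rotational derivative `z ↦ Df(z) (i z)`, that is `∂f/∂θ`. -/
noncomputable def rotDeriv (f : ℂ → ℂ) (z : ℂ) : ℂ := fderiv ℝ f z (Complex.I * z)

theorem clm_apply_eq (L : ℂ →L[ℝ] ℂ) (z : ℂ) : L z = z.re * L 1 + z.im * L Complex.I := by
  conv_lhs => rw [show z = z.re • (1 : ℂ) + z.im • Complex.I by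
    apply Complex.ext <;> simp]
  rw [map_add, map_smul, map_smul, Complex.real_smul, Complex.real_smul]

theorem clm_apply_I_mul_eq (L : ℂ →L[ℝ] ℂ) (z : ℂ) :
    L (Complex.I * z) = z.re * L Complex.I - z.im * L 1 := by
  rw [clm_apply_eq L (Complex.I * z)]
  simp
  ring

/-- The right side is 2z∂_z f. The left side is spelled with two explicit scalars so that
`modeCoeff_linear` applies to it. -/
theorem eulerDeriv_sub_rotDeriv (f : ℂ → ℂ) (z : ℂ) :
    1 * eulerDeriv f z + (-Complex.I) * rotDeriv f z
      = z * (fderiv ℝ f z 1 - Complex.I * fderiv ℝ f z Complex.I) := by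
  rw [eulerDeriv, rotDeriv, clm_apply_I_mul_eq, clm_apply_eq (fderiv ℝ f z) z]
  generalize fderiv ℝ f z = L
  conv_rhs => rw [← Complex.re_add_im z]
  linear_combination ((z.im : ℂ) * L Complex.I) * Complex.I_sq

theorem hasDerivAt_comp_circleMap {F : ℂ → ℂ} {L : ℂ →L[ℝ] ℂ} {s : Set ℂ} {r θ : ℝ}
    (hs : ∀ θ : ℝ, circleMap 0 r θ ∈ s) (hF : HasFDerivWithinAt F L s (circleMap 0 r θ)) :
    HasDerivAt (fun θ => F (circleMap 0 r θ)) (L (Complex.I * circleMap 0 r θ)) θ := by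
  have h := hF.comp_hasDerivAt θ (hasDerivAt_circleMap 0 r θ) (Filter.Eventually.of_forall hs)
  rwa [mul_comm] at h

theorem modeCoeff_fderivWithin_rot {F : ℂ → ℂ} {L : ℂ → ℂ →L[ℝ] ℂ} {s : Set ℂ} {r : ℝ}
    (hs : ∀ θ : ℝ, circleMap 0 r θ ∈ s)
    (hF : ∀ z ∈ s, HasFDerivWithinAt F (L z) s z) (hL : ContinuousOn L s) (n : ℤ) :
    modeCoeff (fun z => L z (Complex.I * z)) r n = Complex.I * n * modeCoeff F r n :=
  modeCoeff_of_hasDerivAt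
    (.of_continuousOn (hL.clm_apply (by fun_prop)) hs)
    (fun θ => hasDerivAt_comp_circleMap hs (hF _ (hs θ))) n

theorem continuousOn_fderiv_of_harmonicOnNhd {f : ℂ → ℂ} {s : Set ℂ} (hs : IsOpen s)
    (hf : HarmonicOnNhd f s) : ContinuousOn (fderiv ℝ f) s :=
  hf.contDiffOn.continuousOn_fderiv_of_isOpen hs (by norm_num)

theorem continuousOn_eulerDeriv {f : ℂ → ℂ} {s : Set ℂ} (hs : IsOpen s)
    (hf : HarmonicOnNhd f s) : ContinuousOn (eulerDeriv f) s :=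
  (continuousOn_fderiv_of_harmonicOnNhd hs hf).clm_apply continuousOn_id

theorem continuousOn_rotDeriv {f : ℂ → ℂ} {s : Set ℂ} (hs : IsOpen s)
    (hf : HarmonicOnNhd f s) : ContinuousOn (rotDeriv f) s :=
  (continuousOn_fderiv_of_harmonicOnNhd hs hf).clm_apply (by fun_prop)

theorem HarmonicOnNhd.hasFDerivAt {f : ℂ → ℂ} {s : Set ℂ} (hf : HarmonicOnNhd f s) {z : ℂ}
    (hz : z ∈ s) : HasFDerivAt f (fderiv ℝ f z) z :=
  ((hf z hz).1.differentiableAt two_ne_zero).hasFDerivAt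

/-- The rotational derivative multiplies the n-th coefficient by `I * n`, so the left side is the
n-th coefficient of the holomorphic function 2z∂_z f. -/
theorem exists_modeCoeff_eulerDeriv_add {f : ℂ → ℂ} {a b : ℝ} (ha : 0 ≤ a)
    (hf : HarmonicOnNhd f (annulus a b)) (n : ℤ) :
    ∃ A : ℂ, ∀ r, a < r → r < b →
      modeCoeff (eulerDeriv f) r n + n * modeCoeff f r n = A * (r : ℂ) ^ n := by
  have key : ∀ r, a < r → r < b →
      modeCoeff (eulerDeriv f) r n + n * modeCoeff f r n
        = modeCoeff (fun z => z * (fderiv ℝ f z 1 - Complex.I * fderiv ℝ f z Complex.I)) r n := by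
    intro r har hrb
    have hmem := circleMap_zero_mem_annulus ha har hrb
    simp only [← eulerDeriv_sub_rotDeriv]
    rw [modeCoeff_linear
      (.of_continuousOn (continuousOn_eulerDeriv (isOpen_annulus a b) hf) hmem)
      (.of_continuousOn (continuousOn_rotDeriv (isOpen_annulus a b) hf) hmem)]
    have := modeCoeff_fderivWithin_rot hmem
      (fun z hz => (HarmonicOnNhd.hasFDerivAt hf hz).hasFDerivWithinAt)
      (continuousOn_fderiv_of_harmonicOnNhd (isOpen_annulus a b) hf) n
    change modeCoeff (rotDeriv f) r n = _ at this
    rw [this]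
    linear_combination (n * modeCoeff f r n) * Complex.I_sq
  have hdiff : DifferentiableOn ℂ
      (fun z => z * (fderiv ℝ f z 1 - Complex.I * fderiv ℝ f z Complex.I)) (annulus a b) :=
    fun z hz => (differentiableAt_id.mul
      (HarmonicAt.differentiableAt_wirtinger (hf z hz))).differentiableWithinAt
  by_cases hab : a < b
  · obtain ⟨m, ham, hmb⟩ := exists_between hab
    refine ⟨modeCoeff (fun z => z * (fderiv ℝ f z 1 - Complex.I * fderiv ℝ f z Complex.I)) m n
      * (m : ℂ) ^ (-n), fun r har hrb => ?_⟩
    have hr : (r : ℂ) ≠ 0 := by exact_mod_cast (ha.trans_lt har).ne'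
    rw [key r har hrb]
    rcases le_total r m with h | h
    · rw [modeCoeff_mul_zpow_eq_of_differentiableOn ha hdiff har h hmb, zpow_neg,
        inv_mul_cancel_right₀ (zpow_ne_zero _ hr)]
    · rw [← modeCoeff_mul_zpow_eq_of_differentiableOn ha hdiff ham h hrb, zpow_neg,
        inv_mul_cancel_right₀ (zpow_ne_zero _ hr)]
  · exact ⟨0, fun r har hrb => absurd (har.trans hrb) hab⟩

theorem HarmonicOnNhd.conj {f : ℂ → ℂ} {s : Set ℂ} (hf : HarmonicOnNhd f s) :
    HarmonicOnNhd (fun z => starRingEnd ℂ (f z)) s :=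
  HarmonicOnNhd.comp_CLM hf (Complex.conjCLE : ℂ →L[ℝ] ℂ)

theorem eulerDeriv_conj {f : ℂ → ℂ} {z : ℂ} (hf : DifferentiableAt ℝ f z) :
    eulerDeriv (fun z => starRingEnd ℂ (f z)) z = starRingEnd ℂ (eulerDeriv f z) := by
  have : fderiv ℝ (fun z => starRingEnd ℂ (f z)) z
      = (Complex.conjCLE : ℂ →L[ℝ] ℂ).comp (fderiv ℝ f z) :=
    ((Complex.conjCLE : ℂ →L[ℝ] ℂ).hasFDerivAt.comp z hf.hasFDerivAt).fderiv
  simp [eulerDeriv, this]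

/-- The previous lemma applied to the conjugate of `f` and to `-n`. -/
theorem exists_modeCoeff_eulerDeriv_sub {f : ℂ → ℂ} {a b : ℝ} (ha : 0 ≤ a)
    (hf : HarmonicOnNhd f (annulus a b)) (n : ℤ) :
    ∃ B : ℂ, ∀ r, a < r → r < b →
      modeCoeff (eulerDeriv f) r n - n * modeCoeff f r n = B * (r : ℂ) ^ (-n) := by
  obtain ⟨A, hA⟩ := exists_modeCoeff_eulerDeriv_add ha (HarmonicOnNhd.conj hf) (-n)
  refine ⟨starRingEnd ℂ A, fun r har hrb => ?_⟩
  have h := congrArg (starRingEnd ℂ) (hA r har hrb)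
  have he : modeCoeff (eulerDeriv fun z => starRingEnd ℂ (f z)) r (-n)
      = starRingEnd ℂ (modeCoeff (eulerDeriv f) r n) := by
    rw [modeCoeff_congr (G := fun z => starRingEnd ℂ (eulerDeriv f z)) (fun θ => eulerDeriv_conj
      (HarmonicOnNhd.hasFDerivAt hf (circleMap_zero_mem_annulus ha har hrb θ)).differentiableAt),
      modeCoeff_conj, neg_neg]
  rw [he, modeCoeff_conj, neg_neg] at h
  simp only [map_add, map_mul, Complex.conj_conj, map_zpow₀, Complex.conj_ofReal] at h
  simpa [sub_eq_add_neg] using h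

theorem hasDerivAt_modeCoeff {f : ℂ → ℂ} {a b r : ℝ} (ha : 0 ≤ a)
    (hf : HarmonicOnNhd f (annulus a b)) (har : a < r) (hrb : r < b) (n : ℤ) :
    HasDerivAt (fun r => modeCoeff f r n) (modeCoeff (eulerDeriv f) r n / r) r := by
  obtain ⟨a', ha', ha'r⟩ := exists_between har
  obtain ⟨b', hb'r, hb'⟩ := exists_between hrb
  have ha'0 : 0 < a' := ha.trans_lt ha'
  have hann := isOpen_annulus a b
  have hmem : ∀ x ∈ Ioo a b, ∀ θ : ℝ, circleMap 0 x θ ∈ annulus a b := fun x hx θ =>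
    circleMap_zero_mem_annulus ha hx.1 hx.2 θ
  have hK : IsCompact (closedBall (0 : ℂ) b' \ ball 0 a') :=
    (isCompact_closedBall 0 b').diff isOpen_ball
  have hKs : closedBall (0 : ℂ) b' \ ball 0 a' ⊆ annulus a b := by
    intro z hz
    simp only [mem_sdiff, mem_closedBall, dist_zero_right, mem_ball, not_lt] at hz
    exact ⟨ha'.trans_le hz.2, hz.1.trans_lt hb'⟩
  obtain ⟨C, hC⟩ := hK.exists_bound_of_continuousOn
    ((continuousOn_fderiv_of_harmonicOnNhd hann hf).mono hKs)
  have hcirc : ∀ x ∈ Ioo a' b', ∀ θ : ℝ, circleMap 0 x θ ∈ closedBall (0 : ℂ) b' \ ball 0 a' := by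
    intro x hx θ
    have h0 : 0 < x := ha'0.trans hx.1
    simp only [mem_sdiff, mem_closedBall, dist_zero_right, mem_ball, not_lt,
      norm_circleMap_zero, abs_of_pos h0]
    exact ⟨hx.2.le, hx.1.le⟩
  have hcont : ∀ x ∈ Ioo a b, Continuous fun θ : ℝ => f (circleMap 0 x θ) := fun x hx =>
    hf.contDiffOn.continuousOn.comp_continuous (continuous_circleMap 0 x) (hmem x hx)
  have hcont' : Continuous fun θ : ℝ =>
      fderiv ℝ f (circleMap 0 r θ) (Complex.exp (θ * Complex.I)) :=
    ((continuousOn_fderiv_of_harmonicOnNhd hann hf).comp_continuous (continuous_circleMap 0 r)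
      (hmem r ⟨har, hrb⟩)).clm_apply (by fun_prop)
  have key := (intervalIntegral.hasDerivAt_integral_of_dominated_loc_of_deriv_le
    (F := fun x θ => Complex.exp (-(n * θ * Complex.I)) * f (circleMap 0 x θ))
    (F' := fun x θ => Complex.exp (-(n * θ * Complex.I)) *
      fderiv ℝ f (circleMap 0 x θ) (Complex.exp (θ * Complex.I)))
    (x₀ := r) (s := Ioo a' b') (μ := volume) (a := 0) (b := 2 * π) (bound := fun _ => C)
    (Ioo_mem_nhds ha'r hb'r) ?_ ?_ ?_ ?_ ?_ ?_).2
  · have h2 := key.const_smul ((2 * π)⁻¹ : ℝ)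
    refine h2.congr_deriv ?_
    rw [modeCoeff, div_eq_mul_inv, smul_mul_assoc, ← intervalIntegral.integral_mul_const]
    congr 1
    refine intervalIntegral.integral_congr fun θ _ => ?_
    have hr : (r : ℂ) ≠ 0 := by exact_mod_cast (ha.trans_lt har).ne'
    have : eulerDeriv f (circleMap 0 r θ)
        = r * fderiv ℝ f (circleMap 0 r θ) (Complex.exp (θ * Complex.I)) := by
      rw [eulerDeriv, ← Complex.real_smul, ← map_smul]
      simp [circleMap]
    simp only [this]
    field_simp
  · filter_upwards [Ioo_mem_nhds har hrb] with x hx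
    exact ((continuous_exp_neg_mode n).mul (hcont x hx)).aestronglyMeasurable
  · exact ((continuous_exp_neg_mode n).mul (hcont r ⟨har, hrb⟩)).intervalIntegrable _ _
  · exact ((continuous_exp_neg_mode n).mul hcont').aestronglyMeasurable
  · refine Filter.Eventually.of_forall fun θ _ x hx => ?_
    rw [norm_mul, show ‖Complex.exp (-(n * θ * Complex.I))‖ = 1 by rw [Complex.norm_exp]; simp,
      one_mul]
    refine (ContinuousLinearMap.le_opNorm _ _).trans ?_
    rw [Complex.norm_exp_ofReal_mul_I, mul_one]
    exact hC _ (hcirc x hx θ)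
  · exact intervalIntegrable_const
  · refine Filter.Eventually.of_forall fun θ _ x hx => ?_
    refine HasDerivAt.const_mul _ ?_
    have hline : HasDerivAt (fun x : ℝ => circleMap 0 x θ) (Complex.exp (θ * Complex.I)) x := by
      have := ((Complex.ofRealCLM.hasDerivAt (x := x)).mul_const (Complex.exp (θ * Complex.I)))
      simpa [circleMap] using this
    exact (HarmonicOnNhd.hasFDerivAt hf (hKs (hcirc x hx θ))).comp_hasDerivAt x hline

/-- For n = 0 the relations with + and - coincide and determine only the Euler derivative. The mode
itself is recovered by integrating A/r, which produces the logarithm. -/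
theorem modeCoeff_zero_eq {f : ℂ → ℂ} {a b : ℝ} (ha : 0 ≤ a)
    (hf : HarmonicOnNhd f (annulus a b)) {A : ℂ}
    (hA : ∀ r, a < r → r < b → modeCoeff (eulerDeriv f) r 0 = A) :
    ∃ c : ℂ, ∀ r, a < r → r < b → modeCoeff f r 0 = c + A * Real.log r := by
  have hd : ∀ r ∈ Ioo a b,
      HasDerivAt (fun r : ℝ => modeCoeff f r 0 - A * (Real.log r : ℂ)) 0 r := by
    intro r hr
    have h1 := hasDerivAt_modeCoeff ha hf hr.1 hr.2 0
    have h2 : HasDerivAt (fun r : ℝ => (Real.log r : ℂ)) ((r⁻¹ : ℝ) : ℂ) r :=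
      (Real.hasDerivAt_log (ha.trans_lt hr.1).ne').ofReal_comp
    refine (h1.sub (h2.const_mul A)).congr_deriv ?_
    rw [hA r hr.1 hr.2]
    push_cast
    ring
  by_cases hab : a < b
  · obtain ⟨m, hm⟩ := exists_between hab
    refine ⟨modeCoeff f m 0 - A * Real.log m, fun r har hrb => ?_⟩
    have := isOpen_Ioo.is_const_of_deriv_eq_zero isPreconnected_Ioo
      (fun x hx => (hd x hx).differentiableAt.differentiableWithinAt)
      (fun x hx => (hd x hx).deriv) (x := r) (y := m) ⟨har, hrb⟩ hm
    linear_combination this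
  · exact ⟨0, fun r har hrb => absurd (har.trans hrb) hab⟩

/-! ### Modes of a harmonic function in the disk. -/

/-- Let r tend to 0. This excludes the profiles that are singular at the centre; the condition `G 0
= 0` is what settles the case `k = 0`. -/
theorem eq_zero_of_mul_pow_eq {G : ℝ → ℂ} {A : ℂ} (hG : ContinuousOn G (Ico 0 1)) (h0 : G 0 = 0)
    {k : ℕ} (h : ∀ r : ℝ, 0 < r → r < 1 → G r * (r : ℂ) ^ k = A) : A = 0 := by
  have heq : EqOn (fun r : ℝ => G r * (r : ℂ) ^ k) (fun _ => A) (Ico 0 1) := by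
    refine EqOn.of_subset_closure (s := Ioo 0 1) (fun r hr => h r hr.1 hr.2)
      (hG.mul (by fun_prop)) continuousOn_const Ioo_subset_Ico_self ?_
    rw [closure_Ioo zero_ne_one]
    exact Ico_subset_Icc_self
  simpa [h0] using (heq (left_mem_Ico.2 zero_lt_one)).symm

theorem circleMap_zero_mem_ball {r : ℝ} (hr : r ∈ Ico (0 : ℝ) 1) (θ : ℝ) :
    circleMap 0 r θ ∈ ball (0 : ℂ) 1 := by
  rw [mem_ball_zero_iff, norm_circleMap_zero, abs_of_nonneg hr.1]
  exact hr.2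

theorem circleMap_zero_mem_closedBall {r : ℝ} (hr : r ∈ Icc (0 : ℝ) 1) (θ : ℝ) :
    circleMap 0 r θ ∈ closedBall (0 : ℂ) 1 := by
  rw [mem_closedBall_zero_iff, norm_circleMap_zero, abs_of_nonneg hr.1]
  exact hr.2

theorem continuousOn_modeCoeff_ball_and_center_eq_zero {f : ℂ → ℂ} (hf : HarmonicOnNhd f (ball 0 1)) (n : ℤ) :
    ContinuousOn (fun r => modeCoeff f r n) (Ico 0 1) ∧
      ContinuousOn (fun r => modeCoeff (eulerDeriv f) r n) (Ico 0 1) ∧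
      modeCoeff (eulerDeriv f) 0 n = 0 ∧ n * modeCoeff f 0 n = 0 := by
  have hmem := fun r (hr : r ∈ Ico (0 : ℝ) 1) => circleMap_zero_mem_ball hr
  refine ⟨continuousOn_modeCoeff hf.contDiffOn.continuousOn hmem n,
    continuousOn_modeCoeff (continuousOn_eulerDeriv isOpen_ball hf) hmem n, ?_, ?_⟩
  · simp [modeCoeff, eulerDeriv]
  · have h := modeCoeff_fderivWithin_rot (hmem 0 (left_mem_Ico.2 zero_lt_one))
      (fun z hz => (HarmonicOnNhd.hasFDerivAt hf hz).hasFDerivWithinAt)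
      (continuousOn_fderiv_of_harmonicOnNhd isOpen_ball hf) n
    have h0 : modeCoeff (fun z => fderiv ℝ f z (Complex.I * z)) 0 n = 0 := by simp [modeCoeff]
    rw [h0, mul_assoc] at h
    exact (mul_eq_zero.1 h.symm).resolve_left Complex.I_ne_zero

/-- Regularity at the centre kills `A` for n ≤ 0 and `B` for n ≥ 0. The surviving constant
determines both the mode and its Euler derivative, and continuity carries the formula for the mode
to r = 1. -/
theorem modeCoeff_of_harmonicOnNhd_ball {f : ℂ → ℂ} (hf : HarmonicOnNhd f (ball 0 1))
    (hc : ContinuousOn f (closedBall 0 1)) (n : ℤ) :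
    (∀ r : ℝ, 0 < r → r ≤ 1 → modeCoeff f r n = modeCoeff f 1 n * (r : ℂ) ^ n.natAbs) ∧
    ∀ r : ℝ, 0 < r → r < 1 →
      modeCoeff (eulerDeriv f) r n = n.natAbs * modeCoeff f 1 n * (r : ℂ) ^ n.natAbs := by
  have hann : HarmonicOnNhd f (annulus 0 1) := fun z hz => hf z (mem_ball_zero_iff.2 hz.2)
  obtain ⟨A, hA⟩ := exists_modeCoeff_eulerDeriv_add le_rfl hann n
  obtain ⟨B, hB⟩ := exists_modeCoeff_eulerDeriv_sub le_rfl hann n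
  obtain ⟨c1, c2, c3, c4⟩ := continuousOn_modeCoeff_ball_and_center_eq_zero hf n
  have hA0 : n ≤ 0 → A = 0 := by
    intro hn
    obtain ⟨k, rfl⟩ := Int.exists_eq_neg_ofNat hn
    refine eq_zero_of_mul_pow_eq (c2.add (c1.const_mul _)) ((congrArg₂ _ c3 c4).trans (add_zero _))
      (k := k) fun r h0 h1 => ?_
    have : (r : ℂ) ≠ 0 := by exact_mod_cast h0.ne'
    refine (congrArg (· * (r : ℂ) ^ k) (hA r h0 h1)).trans ?_
    rw [zpow_neg, zpow_natCast, inv_mul_cancel_right₀ (pow_ne_zero _ this)]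
  have hB0 : 0 ≤ n → B = 0 := by
    intro hn
    obtain ⟨k, rfl⟩ := Int.eq_ofNat_of_zero_le hn
    refine eq_zero_of_mul_pow_eq (c2.sub (c1.const_mul _)) ((congrArg₂ _ c3 c4).trans (sub_zero _))
      (k := k) fun r h0 h1 => ?_
    have : (r : ℂ) ≠ 0 := by exact_mod_cast h0.ne'
    refine (congrArg (· * (r : ℂ) ^ k) (hB r h0 h1)).trans ?_
    rw [zpow_neg, zpow_natCast, inv_mul_cancel_right₀ (pow_ne_zero _ this)]
  obtain ⟨c, hcm, hce⟩ : ∃ c : ℂ,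
      (∀ r : ℝ, 0 < r → r < 1 → modeCoeff f r n = c * (r : ℂ) ^ n.natAbs) ∧
      ∀ r : ℝ, 0 < r → r < 1 →
        modeCoeff (eulerDeriv f) r n = n.natAbs * c * (r : ℂ) ^ n.natAbs := by
    rcases lt_trichotomy n 0 with hn | rfl | hn
    · obtain ⟨k, rfl⟩ := Int.exists_eq_neg_ofNat hn.le
      have hk : (k : ℂ) ≠ 0 := by
        intro h
        rw [Nat.cast_eq_zero] at h
        simp [h] at hn
      have key : ∀ r : ℝ, 0 < r → r < 1 → _ ∧ _ := fun r h0 h1 => ⟨hA r h0 h1, hB r h0 h1⟩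
      simp only [hA0 hn.le, neg_neg, zpow_natCast, Int.cast_neg, Int.cast_natCast, zero_mul]
        at key
      simp only [Int.natAbs_neg, Int.natAbs_natCast]
      refine ⟨B / (2 * k), fun r h0 h1 => ?_, fun r h0 h1 => ?_⟩
      · obtain ⟨h2, h3⟩ := key r h0 h1
        field_simp
        linear_combination h3 - h2
      · obtain ⟨h2, h3⟩ := key r h0 h1
        field_simp
        linear_combination h3 + h2
    · have he : ∀ r : ℝ, 0 < r → r < 1 → modeCoeff (eulerDeriv f) r 0 = 0 := by
        intro r h0 h1
        have := hA r h0 h1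
        simpa [hA0 le_rfl] using this
      obtain ⟨c, hc⟩ := modeCoeff_zero_eq le_rfl hann he
      exact ⟨c, fun r h0 h1 => by simp [hc r h0 h1], fun r h0 h1 => by simp [he r h0 h1]⟩
    · obtain ⟨k, rfl⟩ := Int.eq_ofNat_of_zero_le hn.le
      have hk : (k : ℂ) ≠ 0 := by
        intro h
        rw [Nat.cast_eq_zero] at h
        simp [h] at hn
      have key : ∀ r : ℝ, 0 < r → r < 1 → _ ∧ _ := fun r h0 h1 => ⟨hA r h0 h1, hB r h0 h1⟩
      simp only [hB0 hn.le, zpow_natCast, Int.cast_natCast, zero_mul] at key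
      simp only [Int.natAbs_natCast]
      refine ⟨A / (2 * k), fun r h0 h1 => ?_, fun r h0 h1 => ?_⟩
      · obtain ⟨h2, h3⟩ := key r h0 h1
        field_simp
        linear_combination h2 - h3
      · obtain ⟨h2, h3⟩ := key r h0 h1
        field_simp
        linear_combination h2 + h3
  have heq : EqOn (fun r => modeCoeff f r n) (fun r : ℝ => c * (r : ℂ) ^ n.natAbs) (Icc 0 1) := by
    refine EqOn.of_subset_closure (s := Ioo 0 1) (fun r hr => hcm r hr.1 hr.2)
      (continuousOn_modeCoeff hc (fun r hr => circleMap_zero_mem_closedBall hr) n)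
      (by fun_prop) Ioo_subset_Icc_self ?_
    rw [closure_Ioo zero_ne_one]
  have hc1 : modeCoeff f 1 n = c := by simpa using heq (right_mem_Icc.2 zero_le_one)
  rw [hc1]
  exact ⟨fun r h0 h1 => heq ⟨h0.le, h1⟩, hce⟩

/-! ### Modes on an annulus up to its inner circle. -/

theorem annulus_subset_annulusInnerClosed (a b : ℝ) : annulus a b ⊆ annulusInnerClosed a b :=
  fun _ hz => ⟨hz.1.le, hz.2⟩

/-- Each point lies on the boundary of a small closed disk contained in the set, centred slightly
farther out on the same ray. That disk is convex with nonempty interior. -/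
theorem uniqueDiffOn_annulusInnerClosed {a b : ℝ} (ha : 0 < a) :
    UniqueDiffOn ℝ (annulusInnerClosed a b) := by
  intro z hz
  obtain ⟨ε, hε, hεb⟩ : ∃ ε : ℝ, 0 < ε ∧ ‖z‖ + 2 * ε < b :=
    ⟨(b - ‖z‖) / 4, by linarith [hz.2], by linarith [hz.2]⟩
  have hz0 : 0 < ‖z‖ := ha.trans_le hz.1
  set w : ℂ := ((1 + ε / ‖z‖ : ℝ) : ℂ) * z with hw
  have hwn : ‖w‖ = ‖z‖ + ε := by
    rw [hw, norm_mul, Complex.norm_of_nonneg (by positivity)]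
    field_simp
  have hzw : ‖z - w‖ = ε := by
    have : z - w = ((-(ε / ‖z‖) : ℝ) : ℂ) * z := by rw [hw]; push_cast; ring
    rw [this, norm_mul, Complex.norm_real, norm_neg, Real.norm_of_nonneg (by positivity)]
    field_simp
  have hsub : closedBall w ε ⊆ annulusInnerClosed a b := by
    intro u hu
    rw [mem_closedBall, dist_eq_norm] at hu
    have h1 := norm_sub_norm_le u w
    have h2 := norm_sub_norm_le w u
    rw [norm_sub_rev] at h2
    exact ⟨by linarith [hz.1], by linarith⟩
  refine (uniqueDiffWithinAt_convex (convex_closedBall w ε) ?_ ?_).mono hsub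
  · rw [interior_closedBall w hε.ne']
    exact nonempty_ball.2 hε
  · exact subset_closure (by rw [mem_closedBall, dist_eq_norm, hzw])

theorem circleMap_zero_mem_annulusInnerClosed {a b r : ℝ} (ha : 0 ≤ a) (hr : r ∈ Ico a b) (θ : ℝ) :
    circleMap 0 r θ ∈ annulusInnerClosed a b := by
  have : ‖circleMap 0 r θ‖ = r := by
    rw [norm_circleMap_zero, abs_of_nonneg (ha.trans hr.1)]
  exact ⟨by rw [this]; exact hr.1, by rw [this]; exact hr.2⟩

theorem eulerDeriv_eq_fderivWithin {h : ℂ → ℂ} {a b : ℝ} {z : ℂ} (hz : z ∈ annulus a b) :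
    eulerDeriv h z = fderivWithin ℝ h (annulusInnerClosed a b) z z := by
  rw [eulerDeriv, fderivWithin_of_mem_nhds]
  exact Filter.mem_of_superset ((isOpen_annulus a b).mem_nhds hz)
    (annulus_subset_annulusInnerClosed a b)

/-- The Fourier coefficients of a harmonic function on an annulus, `C¹` up to the inner boundary,
in terms of its boundary value and of its radial derivative on the inner boundary. -/
theorem modeCoeff_of_harmonicOnNhd_annulus {h : ℂ → ℂ} {R : ℝ} (hR : 1 < R)
    (hh : HarmonicOnNhd h (annulus 1 R)) (hC1 : ContDiffOn ℝ 1 h (annulusInnerClosed 1 R))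
    (n : ℤ) {c d : ℂ} (hc : c = modeCoeff h 1 n)
    (hd : d = modeCoeff (fun z => fderivWithin ℝ h (annulusInnerClosed 1 R) z z) 1 n)
    {r : ℝ} (hr : r ∈ Ico 1 R) :
    modeCoeff h r n = (c + d / n.natAbs) / 2 * (r : ℂ) ^ n.natAbs
      + (c - d / n.natAbs) / 2 * ((r : ℂ) ^ n.natAbs)⁻¹
      + if n = 0 then d * Real.log r else 0 := by
  have hmem := fun r (hr : r ∈ Ico (1 : ℝ) R) =>
    circleMap_zero_mem_annulusInnerClosed zero_le_one hr
  have hLc : ContinuousOn (fun z => fderivWithin ℝ h (annulusInnerClosed 1 R) z z)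
      (annulusInnerClosed 1 R) :=
    (hC1.continuousOn_fderivWithin (uniqueDiffOn_annulusInnerClosed one_pos) le_rfl).clm_apply
      continuousOn_id
  have hMc := continuousOn_modeCoeff hC1.continuousOn hmem n
  have hEc := continuousOn_modeCoeff hLc hmem n
  have hE : ∀ r, 1 < r → r < R → modeCoeff (eulerDeriv h) r n
      = modeCoeff (fun z => fderivWithin ℝ h (annulusInnerClosed 1 R) z z) r n :=
    fun r h1 h2 => modeCoeff_congr
      (fun θ => eulerDeriv_eq_fderivWithin (circleMap_zero_mem_annulus zero_le_one h1 h2 θ)) n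
  have hcl : Ico 1 R ⊆ closure (Ioo 1 R) := by
    rw [closure_Ioo hR.ne]
    exact Ico_subset_Icc_self
  have h1mem : (1 : ℝ) ∈ Ico 1 R := left_mem_Ico.2 hR
  have hzc : ∀ m : ℤ, ContinuousOn (fun r : ℝ => (r : ℂ) ^ m) (Ico 1 R) := fun m =>
    Complex.continuous_ofReal.continuousOn.zpow₀ m fun r hr => Or.inl (by
      exact_mod_cast (one_pos.trans_le hr.1).ne')
  obtain ⟨A, hA⟩ := exists_modeCoeff_eulerDeriv_add zero_le_one hh n
  obtain ⟨B, hB⟩ := exists_modeCoeff_eulerDeriv_sub zero_le_one hh n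
  have hA' := EqOn.of_subset_closure (s := Ioo 1 R) (t := Ico 1 R)
    (f := fun r => modeCoeff (fun z => fderivWithin ℝ h (annulusInnerClosed 1 R) z z) r n
      + n * modeCoeff h r n) (g := fun r : ℝ => A * (r : ℂ) ^ n)
    (fun r hr => by simp only [← hE r hr.1 hr.2, hA r hr.1 hr.2])
    (hEc.add (hMc.const_mul _)) ((hzc n).const_mul _) Ioo_subset_Ico_self hcl
  have hB' := EqOn.of_subset_closure (s := Ioo 1 R) (t := Ico 1 R)
    (f := fun r => modeCoeff (fun z => fderivWithin ℝ h (annulusInnerClosed 1 R) z z) r n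
      - n * modeCoeff h r n) (g := fun r : ℝ => B * (r : ℂ) ^ (-n))
    (fun r hr => by simp only [← hE r hr.1 hr.2, hB r hr.1 hr.2])
    (hEc.sub (hMc.const_mul _)) ((hzc (-n)).const_mul _) Ioo_subset_Ico_self hcl
  have hA1 : d + n * c = A := by simpa [← hc, ← hd] using hA' h1mem
  have hB1 : d - n * c = B := by simpa [← hc, ← hd] using hB' h1mem
  have hAr := hA' hr
  have hBr := hB' hr
  simp only [← hA1, ← hB1] at hAr hBr
  have hr0 : (r : ℂ) ≠ 0 := by exact_mod_cast (one_pos.trans_le hr.1).ne'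
  rcases lt_trichotomy n 0 with hn | rfl | hn
  · obtain ⟨k, rfl⟩ := Int.exists_eq_neg_ofNat hn.le
    have hk : (k : ℂ) ≠ 0 := by
      intro h
      rw [Nat.cast_eq_zero] at h
      simp [h] at hn
    rw [if_neg hn.ne]
    simp only [neg_neg, zpow_neg, zpow_natCast, Int.natAbs_neg, Int.natAbs_natCast, Int.cast_neg,
      Int.cast_natCast] at hAr hBr ⊢
    refine mul_left_cancel₀ (mul_ne_zero two_ne_zero hk) ?_
    rw [show 2 * (k : ℂ) * ((c + d / k) / 2 * (r : ℂ) ^ k + (c - d / k) / 2 * ((r : ℂ) ^ k)⁻¹ + 0)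
      = (k * c + d) * (r : ℂ) ^ k + (k * c - d) * ((r : ℂ) ^ k)⁻¹ by
        field_simp
        ring]
    linear_combination hBr - hAr
  · obtain ⟨c', hc'⟩ := modeCoeff_zero_eq zero_le_one hh (A := d) fun r h1 h2 => by
      have := hA r h1 h2
      simpa [← hA1] using this
    have h0 := EqOn.of_subset_closure (s := Ioo 1 R) (t := Ico 1 R)
      (f := fun r => modeCoeff h r 0) (g := fun r : ℝ => c' + d * Real.log r)
      (fun r hr => hc' r hr.1 hr.2) hMc
      (continuousOn_const.add (continuousOn_const.mul
        (Complex.continuous_ofReal.comp_continuousOn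
          (Real.continuousOn_log.mono fun r hr => (one_pos.trans_le hr.1).ne'))))
      Ioo_subset_Ico_self hcl
    have h1 : c = c' := by simpa [← hc] using h0 h1mem
    have h2 := h0 hr
    simp only at h2
    -- Since `d / 0 = 0`, the two power terms of the statement are c/2 each for n = 0 and add up to
    -- c.
    rw [h2, h1]
    simp
  · obtain ⟨k, rfl⟩ := Int.eq_ofNat_of_zero_le hn.le
    have hk : (k : ℂ) ≠ 0 := by
      intro h
      rw [Nat.cast_eq_zero] at h
      simp [h] at hn
    rw [if_neg hn.ne']
    simp only [zpow_neg, zpow_natCast, Int.natAbs_natCast, Int.cast_natCast] at hAr hBr ⊢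
    refine mul_left_cancel₀ (mul_ne_zero two_ne_zero hk) ?_
    rw [show 2 * (k : ℂ) * ((c + d / k) / 2 * (r : ℂ) ^ k + (c - d / k) / 2 * ((r : ℂ) ^ k)⁻¹ + 0)
      = (k * c + d) * (r : ℂ) ^ k + (k * c - d) * ((r : ℂ) ^ k)⁻¹ by
        field_simp
        ring]
    linear_combination hAr - hBr

/-! ### Harmonic power series, reflection, and regularity of the extension. -/

theorem summable_pow_natAbs {q : ℝ} (h0 : 0 ≤ q) (h1 : q < 1) :
    Summable fun n : ℤ => q ^ n.natAbs := by
  refine Summable.of_nat_of_neg ?_ ?_ <;> simpa using summable_geometric_of_lt_one h0 h1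

theorem summable_norm_mul_pow_natAbs {a : ℤ → ℂ} {C s q : ℝ} (hs : 0 < s)
    (ha : ∀ n, ‖a n‖ * s ^ n.natAbs ≤ C) (hq : 0 ≤ q) (hqs : q < s) :
    Summable fun n : ℤ => ‖a n‖ * q ^ n.natAbs := by
  refine Summable.of_nonneg_of_le (fun n => by positivity) (fun n => ?_)
    ((summable_pow_natAbs (q := q / s) (by positivity) ((div_lt_one hs).2 hqs)).mul_left C)
  calc ‖a n‖ * q ^ n.natAbs = ‖a n‖ * s ^ n.natAbs * (q / s) ^ n.natAbs := by
        rw [div_pow]; field_simp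
    _ ≤ C * (q / s) ^ n.natAbs := by gcongr; exact ha n

theorem differentiableOn_tsum_mul_pow_natAbs {a : ℤ → ℂ} {R : ℝ}
    (ha : ∀ q, 0 ≤ q → q < R → Summable fun n : ℤ => ‖a n‖ * q ^ n.natAbs) :
    DifferentiableOn ℂ (fun z => ∑' n : ℤ, a n * z ^ n.natAbs) (ball 0 R) := by
  intro z hz
  rw [mem_ball_zero_iff] at hz
  obtain ⟨q, hzq, hqR⟩ := exists_between hz
  have := Complex.differentiableOn_tsum_of_summable_norm
    (ha q ((norm_nonneg z).trans hzq.le) hqR) (F := fun (n : ℤ) z => a n * z ^ n.natAbs)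
    (U := ball 0 q) (fun n => by fun_prop) isOpen_ball fun n w hw => by
      rw [norm_mul, norm_pow]
      gcongr
      exact (mem_ball_zero_iff.1 hw).le
  exact (this.differentiableAt (isOpen_ball.mem_nhds
    (mem_ball_zero_iff.2 hzq))).differentiableWithinAt

/-- The harmonic monomial `r^|n| e^{inθ}`. -/
noncomputable def harmonicMonomial (n : ℤ) (z : ℂ) : ℂ :=
  if 0 ≤ n then z ^ n.natAbs else (starRingEnd ℂ z) ^ n.natAbs

theorem harmonicMonomial_circleMap (n : ℤ) (r θ : ℝ) :
    harmonicMonomial n (circleMap 0 r θ) = (r : ℂ) ^ n.natAbs * Complex.exp (n * θ * Complex.I) := by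
  rw [harmonicMonomial]
  split_ifs with hn
  · obtain ⟨k, rfl⟩ := Int.eq_ofNat_of_zero_le hn
    simp only [circleMap, zero_add, mul_pow, Int.natAbs_natCast, ← Complex.exp_nat_mul]
    push_cast
    ring_nf
  · obtain ⟨k, rfl⟩ := Int.exists_eq_neg_ofNat (not_le.1 hn).le
    simp only [circleMap, zero_add, map_mul, Complex.conj_ofReal, mul_pow, Int.natAbs_neg,
      Int.natAbs_natCast, ← Complex.exp_conj, ← Complex.exp_nat_mul, Complex.conj_I]
    push_cast
    ring_nf

theorem norm_harmonicMonomial (n : ℤ) (z : ℂ) : ‖harmonicMonomial n z‖ = ‖z‖ ^ n.natAbs := by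
  rw [harmonicMonomial]
  split_ifs <;> simp

theorem hasSum_harmonicMonomial {a : ℤ → ℂ} {R : ℝ}
    (ha : ∀ q, 0 ≤ q → q < R → Summable fun n : ℤ => ‖a n‖ * q ^ n.natAbs) {z : ℂ}
    (hz : ‖z‖ < R) :
    HasSum (fun n => a n * harmonicMonomial n z) (∑' n : ℤ, a n * harmonicMonomial n z) := by
  refine Summable.hasSum (Summable.of_norm ?_)
  simpa only [norm_mul, norm_harmonicMonomial] using ha _ (norm_nonneg z) hz

/-- The indices n ≥ 0 give a power series in z and the indices n < 0 one in z̄; each is holomorphic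
in its variable. -/
theorem contDiffOn_tsum_harmonicMonomial {a : ℤ → ℂ} {R : ℝ}
    (ha : ∀ q, 0 ≤ q → q < R → Summable fun n : ℤ => ‖a n‖ * q ^ n.natAbs) :
    ContDiffOn ℝ 1 (fun z => ∑' n : ℤ, a n * harmonicMonomial n z) (ball 0 R) := by
  have hb : ∀ b : ℤ → ℂ, (∀ n, ‖b n‖ ≤ ‖a n‖) →
      ContDiffOn ℝ 1 (fun z => ∑' n : ℤ, b n * z ^ n.natAbs) (ball 0 R) := by
    intro b hb
    have hd : DifferentiableOn ℂ (fun z => ∑' n : ℤ, b n * z ^ n.natAbs) (ball 0 R) :=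
      differentiableOn_tsum_mul_pow_natAbs fun q h0 h1 =>
        Summable.of_nonneg_of_le (fun n => by positivity)
          (fun n => by gcongr; exact hb n) (ha q h0 h1)
    exact (hd.contDiffOn isOpen_ball (n := 1)).restrict_scalars ℝ
  have h1 := hb (fun n => if 0 ≤ n then a n else 0) fun n => by split_ifs <;> simp
  have h2 := hb (fun n => if 0 ≤ n then 0 else a n) fun n => by split_ifs <;> simp
  have h3 := h2.comp (s := ball 0 R) (f := fun z => starRingEnd ℂ z)
    Complex.conjCLE.contDiff.contDiffOn (fun z hz => by simpa using hz)
  refine (h1.add h3).congr fun z hz => ?_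
  rw [mem_ball_zero_iff] at hz
  have s1 : Summable fun n : ℤ => (if 0 ≤ n then a n else 0) * z ^ n.natAbs := by
    refine Summable.of_norm (Summable.of_nonneg_of_le (fun n => norm_nonneg _) (fun n => ?_)
      (ha _ (norm_nonneg z) hz))
    split_ifs <;> simp [mul_nonneg]
  have s2 : Summable fun n : ℤ => (if 0 ≤ n then 0 else a n) * (starRingEnd ℂ z) ^ n.natAbs := by
    refine Summable.of_norm (Summable.of_nonneg_of_le (fun n => norm_nonneg _) (fun n => ?_)
      (ha _ (norm_nonneg z) hz))
    split_ifs <;> simp [mul_nonneg]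
  simp only [Function.comp_apply]
  rw [← s1.tsum_add s2]
  refine tsum_congr fun n => ?_
  rw [harmonicMonomial]
  split_ifs <;> simp

theorem inv_conj_circleMap {r : ℝ} (θ : ℝ) :
    (starRingEnd ℂ (circleMap 0 r θ))⁻¹ = circleMap 0 r⁻¹ θ := by
  simp only [circleMap, zero_add, map_mul, Complex.conj_ofReal, mul_inv, ← Complex.exp_conj,
    Complex.conj_I, ← Complex.exp_neg]
  push_cast
  ring_nf

/-- Reflection formula for the harmonic extension into the disk of the boundary values of a
harmonic function in an outer annulus. -/
theorem IsHarmonicExtension.exists_reflection {h f : ℂ → ℂ} {R : ℝ} (hR : 1 < R)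
    (hh : HarmonicOnNhd h (annulus 1 R)) (hC1 : ContDiffOn ℝ 1 h (annulusInnerClosed 1 R))
    (hf : IsHarmonicExtension h f) :
    ∃ (d : ℂ) (u : ℂ → ℂ), ContDiffOn ℝ 1 u (ball 0 R) ∧ ∀ z : ℂ, R⁻¹ < ‖z‖ → ‖z‖ ≤ 1 →
      f z = h (starRingEnd ℂ z)⁻¹ + d * Real.log ‖z‖ + (u z - u (starRingEnd ℂ z)⁻¹) := by
  have hR0 : 0 < R := one_pos.trans hR
  have hmem := fun r (hr : r ∈ Ico (1 : ℝ) R) =>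
    circleMap_zero_mem_annulusInnerClosed zero_le_one hr
  set c : ℤ → ℂ := fun n => modeCoeff h 1 n with hc
  set d : ℤ → ℂ := fun n =>
    modeCoeff (fun z => fderivWithin ℝ h (annulusInnerClosed 1 R) z z) 1 n with hd
  set g : ℤ → ℂ := fun n => (c n + d n / n.natAbs) / 2 with hg
  have h1R : (1 : ℝ) ∈ Ico 1 R := left_mem_Ico.2 hR
  have hmodes : ∀ r ∈ Ico 1 R, ∀ n : ℤ, modeCoeff h r n = g n * (r : ℂ) ^ n.natAbs
      + (c n - g n) * ((r : ℂ) ^ n.natAbs)⁻¹ + if n = 0 then d 0 * Real.log r else 0 := by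
    intro r hr n
    rw [modeCoeff_of_harmonicOnNhd_annulus hR hh hC1 n (c := c n) (d := d n) rfl rfl hr]
    have : (c n - d n / n.natAbs) / 2 = c n - g n := by simp only [hg]; ring
    rw [this]
    by_cases hn : n = 0
    · subst hn
      have : g 0 = c 0 / 2 := by simp [hg]
      simp [this]
    · simp [hn, hg]
  have hLc : ContinuousOn (fun z => fderivWithin ℝ h (annulusInnerClosed 1 R) z z)
      (annulusInnerClosed 1 R) :=
    (hC1.continuousOn_fderivWithin (uniqueDiffOn_annulusInnerClosed one_pos) le_rfl).clm_apply
      continuousOn_id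
  have hhcirc : ∀ r ∈ Ico 1 R, ContinuousOnCircle h r := fun r hr =>
    .of_continuousOn hC1.continuousOn (hmem r hr)
  obtain ⟨C₁, hC₁0, hC₁⟩ := (hhcirc 1 h1R).exists_norm_modeCoeff_le
  obtain ⟨C₂, hC₂0, hC₂⟩ := ContinuousOnCircle.exists_norm_modeCoeff_le
    (.of_continuousOn hLc (hmem 1 h1R))
  have hdn : ∀ n : ℤ, ‖d n / n.natAbs‖ ≤ C₂ := by
    intro n
    rw [norm_div, Complex.norm_natCast]
    rcases Nat.eq_zero_or_pos n.natAbs with h0 | h0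
    · rw [h0]; simpa using hC₂0
    · exact (div_le_self (norm_nonneg _) (by exact_mod_cast h0)).trans (hC₂ n)
  have hcg : ∀ n : ℤ, ‖c n - g n‖ ≤ (C₁ + C₂) / 2 := by
    intro n
    have : c n - g n = (c n - d n / n.natAbs) / 2 := by simp only [hg]; ring
    rw [this, norm_div, Complex.norm_ofNat]
    gcongr
    exact (norm_sub_le _ _).trans (add_le_add (hC₁ n) (hdn n))
  have hsum : ∀ q, 0 ≤ q → q < R → Summable fun n : ℤ => ‖g n‖ * q ^ n.natAbs := by
    intro q hq0 hqR
    -- The modes of `h` are bounded on the circle of radius s, and s > 1 keeps the decaying terms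
    -- bounded. Hence g_n s^|n| is bounded, and the series converges geometrically at q < s.
    obtain ⟨s, hs, hsR⟩ := exists_between (max_lt hqR hR)
    have hs1 : 1 < s := (le_max_right _ _).trans_lt hs
    have hqs : q < s := (le_max_left _ _).trans_lt hs
    obtain ⟨C₃, hC₃0, hC₃⟩ := (hhcirc s ⟨hs1.le, hsR⟩).exists_norm_modeCoeff_le
    refine summable_norm_mul_pow_natAbs (s := s)
      (C := C₃ + (C₁ + C₂) / 2 + ‖d 0 * Real.log s‖) (one_pos.trans hs1) (fun n => ?_) hq0 hqs
    have hm := hmodes s ⟨hs1.le, hsR⟩ n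
    have hgn : g n * (s : ℂ) ^ n.natAbs = modeCoeff h s n
        - (c n - g n) * ((s : ℂ) ^ n.natAbs)⁻¹ - if n = 0 then d 0 * Real.log s else 0 := by
      rw [hm]; ring
    have hns : ‖g n‖ * s ^ n.natAbs = ‖g n * (s : ℂ) ^ n.natAbs‖ := by
      rw [norm_mul, norm_pow, Complex.norm_of_nonneg (one_pos.trans hs1).le]
    rw [hns, hgn]
    refine (norm_sub_le _ _).trans (add_le_add ((norm_sub_le _ _).trans
      (add_le_add (hC₃ n) ?_)) ?_)
    · rw [norm_mul, norm_inv, norm_pow, Complex.norm_of_nonneg (one_pos.trans hs1).le]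
      exact (mul_le_of_le_one_right (norm_nonneg _)
        (inv_le_one_of_one_le₀ (one_le_pow₀ hs1.le))).trans (hcg n)
    · split_ifs
      · exact le_rfl
      · simpa only [norm_zero] using norm_nonneg _
  refine ⟨d 0, fun z => ∑' n : ℤ, g n * harmonicMonomial n z,
    contDiffOn_tsum_harmonicMonomial hsum, fun z hz1 hz2 => ?_⟩
  obtain ⟨r, θ, hr0, rfl⟩ : ∃ r θ : ℝ, 0 < r ∧ z = circleMap 0 r θ := by
    refine ⟨‖z‖, z.arg, (inv_pos.2 hR0).trans hz1, ?_⟩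
    rw [circleMap, zero_add, Complex.norm_mul_exp_arg_mul_I]
  rw [norm_circleMap_zero, abs_of_pos hr0] at hz1 hz2
  rw [inv_conj_circleMap, norm_circleMap_zero, abs_of_pos hr0]
  rcases hz2.eq_or_lt with rfl | hr1
  · have : f (circleMap 0 1 θ) = h (circleMap 0 1 θ) :=
      hf.eqOn (circleMap_mem_sphere 0 zero_le_one θ)
    simp [this]
  have hrinv : r⁻¹ ∈ Ico 1 R :=
    ⟨(one_le_inv₀ hr0).2 hr1.le, (inv_lt_comm₀ hR0 hr0).1 hz1⟩
  have hrC : (r : ℂ) ≠ 0 := by exact_mod_cast hr0.ne'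
  have hcf : ∀ n, modeCoeff f r n = c n * (r : ℂ) ^ n.natAbs := by
    intro n
    rw [(modeCoeff_of_harmonicOnNhd_ball hf.harmonic hf.continuousOn n).1 r hr0 hr1.le]
    rw [modeCoeff_congr (G := h) fun θ => hf.eqOn (circleMap_mem_sphere 0 zero_le_one θ)]
  have hfr : ContinuousOnCircle f r := .of_continuousOn hf.continuousOn
    fun θ => circleMap_zero_mem_closedBall ⟨hr0.le, hr1.le⟩ θ
  have hbdd : ∀ b : ℤ → ℂ, ∀ C : ℝ, (∀ n, ‖b n‖ ≤ C) →
      Summable fun n => b n * (r : ℂ) ^ n.natAbs := by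
    intro b C hb
    refine Summable.of_norm (Summable.of_nonneg_of_le (fun n => norm_nonneg _) (fun n => ?_)
      ((summable_pow_natAbs hr0.le hr1).mul_left C))
    rw [norm_mul, norm_pow, Complex.norm_of_nonneg hr0.le]
    gcongr
    exact hb n
  have sf : Summable (modeCoeff f r) := by
    rw [show modeCoeff f r = fun n => c n * (r : ℂ) ^ n.natAbs from funext hcf]
    exact hbdd c C₁ hC₁
  have sh : Summable (modeCoeff h r⁻¹) := by
    rw [show modeCoeff h r⁻¹ = _ from funext (hmodes r⁻¹ hrinv)]
    refine (Summable.add ?_ ?_).add ?_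
    · refine Summable.of_norm ?_
      refine (hsum r⁻¹ (by positivity) hrinv.2).congr fun n => ?_
      rw [norm_mul, norm_pow, Complex.norm_of_nonneg (by positivity)]
    · refine (hbdd (fun n => c n - g n) _ hcg).congr fun n => ?_
      push_cast
      rw [inv_pow, inv_inv]
    · exact (hasSum_ite_eq (0 : ℤ) (d 0 * (Real.log r⁻¹ : ℂ))).summable
  have H1 := hasSum_modeCoeff hfr sf θ
  have H2 := hasSum_modeCoeff (hhcirc r⁻¹ hrinv) sh θ
  have H3 := hasSum_harmonicMonomial (z := circleMap 0 r θ) hsum (by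
    rw [norm_circleMap_zero, abs_of_pos hr0]; exact hr1.trans hR)
  have H4 := hasSum_harmonicMonomial (z := circleMap 0 r⁻¹ θ) hsum (by
    rw [norm_circleMap_zero, abs_of_pos (inv_pos.2 hr0)]; exact hrinv.2)
  have H5 := hasSum_ite_eq (0 : ℤ) (d 0 * (Real.log r : ℂ))
  -- At radius 1/r the terms of `h` are g_n r^(-|n|) + (c_n - g_n) r^|n|, with an extra -d log r for
  -- n = 0. Adding u(z) - u(1/z̄) and d log r leaves c_n r^|n|, the mode of `f`.
  refine H1.unique ?_
  refine ((H2.add H5).add (H3.sub H4)).congr_fun fun n => ?_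
  rw [hcf, hmodes _ hrinv, harmonicMonomial_circleMap, harmonicMonomial_circleMap]
  push_cast
  rw [Real.log_inv]
  by_cases hn : n = 0
  · subst hn
    simp
  · simp only [if_neg hn, inv_pow, inv_inv]
    ring

theorem IsHarmonicExtension.contDiffOn_closedBall {h f : ℂ → ℂ} {R : ℝ} (hR : 1 < R)
    (hh : HarmonicOnNhd h (annulus 1 R)) (hC1 : ContDiffOn ℝ 1 h (annulusInnerClosed 1 R))
    (hf : IsHarmonicExtension h f) : ContDiffOn ℝ 1 f (closedBall 0 1) := by
  intro z hz
  rw [mem_closedBall_zero_iff] at hz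
  rcases hz.lt_or_eq with hz1 | hz1
  · exact ((hf.harmonic z (mem_ball_zero_iff.2 hz1)).1.of_le one_le_two).contDiffWithinAt
  obtain ⟨d, u, hu, hrefl⟩ := hf.exists_reflection hR hh hC1
  have hR0 : 0 < R := one_pos.trans hR
  set W : Set ℂ := closedBall 0 1 ∩ {w | R⁻¹ < ‖w‖} with hW
  have hWpos : ∀ w ∈ W, 0 < ‖w‖ := fun w hw => (inv_pos.2 hR0).trans hw.2
  have hinv : ContDiffOn ℝ 1 (fun w : ℂ => (starRingEnd ℂ w)⁻¹) W :=
    Complex.conjCLE.contDiff.contDiffOn.inv fun w hw => by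
      simpa using norm_pos_iff.1 (hWpos w hw)
  have hinvR : ∀ w ∈ W, ‖(starRingEnd ℂ w)⁻¹‖ < R := fun w hw => by
    rw [norm_inv, RCLike.norm_conj]
    exact (inv_lt_comm₀ hR0 (hWpos w hw)).1 hw.2
  have h1 : ContDiffOn ℝ 1 (fun w : ℂ => h (starRingEnd ℂ w)⁻¹) W :=
    hC1.comp hinv fun w hw => ⟨by
      rw [norm_inv, RCLike.norm_conj, one_le_inv₀ (hWpos w hw)]
      exact mem_closedBall_zero_iff.1 hw.1, hinvR w hw⟩
  have h2 : ContDiffOn ℝ 1 (fun w : ℂ => d * (Real.log ‖w‖ : ℂ)) W :=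
    contDiffOn_const.mul (Complex.ofRealCLM.contDiff.comp_contDiffOn
      ((contDiffOn_id.norm ℝ fun w hw => norm_pos_iff.1 (hWpos w hw)).log
        fun w hw => (hWpos w hw).ne'))
  have h3 : ContDiffOn ℝ 1 u W := hu.mono fun w hw => by
    rw [mem_ball_zero_iff]
    exact (mem_closedBall_zero_iff.1 hw.1).trans_lt hR
  have h4 : ContDiffOn ℝ 1 (fun w : ℂ => u (starRingEnd ℂ w)⁻¹) W :=
    hu.comp hinv fun w hw => mem_ball_zero_iff.2 (hinvR w hw)
  have hfW : ContDiffOn ℝ 1 f W := ((h1.add h2).add (h3.sub h4)).congr fun w hw =>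
    hrefl w hw.2 (mem_closedBall_zero_iff.1 hw.1)
  have hzR : R⁻¹ < ‖z‖ := by rw [hz1]; exact inv_lt_one_of_one_lt₀ hR
  refine (hfW z ⟨mem_closedBall_zero_iff.2 hz, hzR⟩).mono_of_mem_nhdsWithin ?_
  exact Filter.inter_mem self_mem_nhdsWithin
    (mem_nhdsWithin_of_mem_nhds ((isOpen_lt continuous_const continuous_norm).mem_nhds hzR))

/-! ### Jacobian and Dirichlet energy as Fourier sums. -/

theorem clm_det_eq (L : ℂ →L[ℝ] ℂ) :
    L.det = (L 1).re * (L Complex.I).im - (L Complex.I).re * (L 1).im := by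
  rw [ContinuousLinearMap.det, ← LinearMap.det_toMatrix Complex.basisOneI, Matrix.det_fin_two]
  simp [LinearMap.toMatrix_apply]

/-- For |z| = 1 the vectors z and iz form a positive orthonormal basis, so the determinant is Im of
conj(Lz)·L(iz). -/
theorem clm_det_eq_polar (L : ℂ →L[ℝ] ℂ) {z : ℂ} (hz : ‖z‖ = 1) :
    L.det = (starRingEnd ℂ (L z) * (0 * L z + (-Complex.I) * L (Complex.I * z))).re := by
  have h1 : z.re * z.re + z.im * z.im = 1 := by
    rw [← Complex.normSq_apply, ← Complex.sq_norm, hz, one_pow]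
  rw [clm_det_eq, clm_apply_I_mul_eq, clm_apply_eq L z]
  simp
  linear_combination (-((L 1).re * (L Complex.I).im - (L Complex.I).re * (L 1).im)) * h1

theorem norm_sq_clm_apply_add (L : ℂ →L[ℝ] ℂ) (z : ℂ) :
    ‖1 * L z + 0 * L z‖ ^ 2 + ‖L (Complex.I * z)‖ ^ 2
      = ‖z‖ ^ 2 * (‖L 1‖ ^ 2 + ‖L Complex.I‖ ^ 2) := by
  rw [clm_apply_I_mul_eq, clm_apply_eq L z]
  simp only [Complex.sq_norm, Complex.normSq_apply]
  simp
  ring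

theorem hasSum_jacobianWithin {F : ℂ → ℂ} {s : Set ℂ} (hs : UniqueDiffOn ℝ s)
    (hF : ContDiffOn ℝ 1 F s) (hmem : ∀ θ : ℝ, circleMap 0 1 θ ∈ s) :
    HasSum (fun n : ℤ => n *
        (starRingEnd ℂ (modeCoeff F 1 n) * modeCoeff (fun z => fderivWithin ℝ F s z z) 1 n).re)
      (circleAverage (jacobianWithin F s) 0 1) := by
  have hL := hF.continuousOn_fderivWithin hs le_rfl
  have hE : ContinuousOnCircle (fun z => fderivWithin ℝ F s z z) 1 :=
    .of_continuousOn (hL.clm_apply continuousOn_id) hmem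
  have hT : ContinuousOnCircle (fun z => fderivWithin ℝ F s z (Complex.I * z)) 1 :=
    .of_continuousOn (hL.clm_apply (by fun_prop)) hmem
  have h := hasSum_re_conj_mul_modeCoeff hE (hE.linear hT 0 (-Complex.I))
  convert h using 1
  · funext n
    rw [modeCoeff_linear hE hT, modeCoeff_fderivWithin_rot hmem
      (fun z hz => (hF.differentiableOn one_ne_zero z hz).hasFDerivWithinAt) hL]
    simp
    ring
  · rw [circleAverage, circleAverage]
    congr 1
    refine intervalIntegral.integral_congr fun θ _ => ?_
    exact clm_det_eq_polar _ (by simp)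

theorem uniqueDiffOn_closedBall : UniqueDiffOn ℝ (closedBall (0 : ℂ) 1) :=
  uniqueDiffOn_convex (convex_closedBall 0 1) (by
    rw [interior_closedBall (0 : ℂ) one_ne_zero]
    exact nonempty_ball.2 one_pos)

theorem fderivWithin_closedBall_eq {f : ℂ → ℂ} {z : ℂ} (hz : z ∈ ball (0 : ℂ) 1) :
    fderivWithin ℝ f (closedBall 0 1) z = fderiv ℝ f z :=
  fderivWithin_of_mem_nhds (Filter.mem_of_superset (isOpen_ball.mem_nhds hz)
    ball_subset_closedBall)

theorem modeCoeff_radial_of_harmonicOnNhd_ball {f : ℂ → ℂ} (hf : HarmonicOnNhd f (ball 0 1))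
    (hC1 : ContDiffOn ℝ 1 f (closedBall 0 1)) (n : ℤ) :
    modeCoeff (fun z => fderivWithin ℝ f (closedBall 0 1) z z) 1 n
      = n.natAbs * modeCoeff f 1 n := by
  have hLc : ContinuousOn (fun z => fderivWithin ℝ f (closedBall 0 1) z z) (closedBall 0 1) :=
    (hC1.continuousOn_fderivWithin uniqueDiffOn_closedBall le_rfl).clm_apply continuousOn_id
  have heq : EqOn (fun r => modeCoeff (fun z => fderivWithin ℝ f (closedBall 0 1) z z) r n)
      (fun r : ℝ => n.natAbs * modeCoeff f 1 n * (r : ℂ) ^ n.natAbs) (Icc 0 1) := by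
    refine EqOn.of_subset_closure (s := Ioo 0 1) (fun r hr => ?_)
      (continuousOn_modeCoeff hLc (fun r hr => circleMap_zero_mem_closedBall hr) n)
      (by fun_prop) Ioo_subset_Icc_self (by rw [closure_Ioo zero_ne_one])
    have := (modeCoeff_of_harmonicOnNhd_ball hf hC1.continuousOn n).2 r hr.1 hr.2
    rw [← this]
    refine modeCoeff_congr (fun θ => ?_) n
    rw [fderivWithin_closedBall_eq (circleMap_zero_mem_ball ⟨hr.1.le, hr.2⟩ θ), eulerDeriv]
  simpa using heq (right_mem_Icc.2 zero_le_one)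

theorem setIntegral_ball_eq_circleAverage {g : ℂ → ℝ} (hg : ContinuousOn g (ball 0 1)) {C : ℝ}
    (hC : ∀ z ∈ ball (0 : ℂ) 1, ‖g z‖ ≤ C) :
    ∫ z in ball (0 : ℂ) 1, g z = 2 * π * ∫ r in (0 : ℝ)..1, r * circleAverage g 0 r := by
  have hsymm : ∀ p : ℝ × ℝ, Complex.polarCoord.symm p = circleMap 0 p.1 p.2 := by
    intro p
    rw [Complex.polarCoord_symm_apply, circleMap, zero_add, Complex.exp_mul_I]
    push_cast
    rfl
  have hprod : MeasurableSet (Ioo (0 : ℝ) 1 ×ˢ Ioo (-π) π) :=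
    measurableSet_Ioo.prod measurableSet_Ioo
  have hmem : ∀ p ∈ Ioo (0 : ℝ) 1 ×ˢ Ioo (-π) π, circleMap 0 p.1 p.2 ∈ ball (0 : ℂ) 1 :=
    fun p hp => circleMap_zero_mem_ball ⟨hp.1.1.le, hp.1.2⟩ p.2
  have h1 : ∫ z in ball (0 : ℂ) 1, g z
      = ∫ p in Ioo (0 : ℝ) 1 ×ˢ Ioo (-π) π, p.1 * g (circleMap 0 p.1 p.2) := by
    rw [← integral_indicator measurableSet_ball, ← Complex.integral_comp_polarCoord_symm,
      ← integral_indicator hprod, polarCoord_target,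
      ← integral_indicator (measurableSet_Ioi.prod measurableSet_Ioo)]
    congr 1
    funext p
    simp only [hsymm, smul_eq_mul, indicator, mem_prod, mem_ball_zero_iff, norm_circleMap_zero]
    by_cases hp : p.1 ∈ Ioi 0 ∧ p.2 ∈ Ioo (-π) π
    · rw [if_pos hp, abs_of_pos hp.1]
      by_cases hp1 : p.1 < 1
      · rw [if_pos hp1, if_pos ⟨⟨hp.1, hp1⟩, hp.2⟩]
      · rw [if_neg hp1, if_neg fun h => hp1 h.1.2, mul_zero]
    · rw [if_neg hp, if_neg fun h => hp ⟨h.1.1, h.2⟩]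
  have hcont : ContinuousOn (fun p : ℝ × ℝ => p.1 * g (circleMap 0 p.1 p.2))
      (Ioo (0 : ℝ) 1 ×ˢ Ioo (-π) π) := by
    refine continuousOn_fst.mul (hg.comp (Continuous.continuousOn ?_) hmem)
    unfold circleMap
    fun_prop
  have hint : IntegrableOn (fun p : ℝ × ℝ => p.1 * g (circleMap 0 p.1 p.2))
      (Ioo (0 : ℝ) 1 ×ˢ Ioo (-π) π) (volume.prod volume) := by
    refine IntegrableOn.of_bound ?_ (hcont.aestronglyMeasurable hprod) C ?_
    · rw [Measure.prod_prod]
      simp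
    · refine (ae_restrict_iff' hprod).2 (Filter.Eventually.of_forall fun p hp => ?_)
      rw [norm_mul, Real.norm_of_nonneg hp.1.1.le]
      exact (mul_le_of_le_one_left (norm_nonneg _) hp.1.2.le).trans (hC _ (hmem p hp))
  rw [h1, Measure.volume_eq_prod, setIntegral_prod _ hint,
    intervalIntegral.integral_of_le zero_le_one, integral_Ioc_eq_integral_Ioo,
    ← integral_const_mul]
  refine setIntegral_congr_fun measurableSet_Ioo fun r hr => ?_
  simp only
  rw [integral_const_mul, ← integral_Ioc_eq_integral_Ioo,
    ← intervalIntegral.integral_of_le (by linarith [pi_pos]), circleAverage, smul_eq_mul]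
  have hper : Function.Periodic (fun θ => g (circleMap 0 r θ)) (2 * π) := fun θ => by
    simp only [(periodic_circleMap 0 r) θ]
  have := hper.intervalIntegral_add_eq (-π) 0
  rw [show -π + 2 * π = π by ring, zero_add] at this
  rw [this]
  have := pi_pos
  field_simp

theorem hasSum_circleAverage_hilbertSchmidtSq {f : ℂ → ℂ} (hf : HarmonicOnNhd f (ball 0 1))
    (hc : ContinuousOn f (closedBall 0 1)) {r : ℝ} (hr : r ∈ Ioo 0 1) :
    HasSum (fun n : ℤ => 2 * (n.natAbs * ‖modeCoeff f 1 n‖) ^ 2 * r ^ (2 * n.natAbs - 1))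
      (r * circleAverage (hilbertSchmidtSq f) 0 r) := by
  have hmem := circleMap_zero_mem_ball ⟨hr.1.le, hr.2⟩
  have hL := continuousOn_fderiv_of_harmonicOnNhd isOpen_ball hf
  have hE : ContinuousOnCircle (eulerDeriv f) r :=
    .of_continuousOn (continuousOn_eulerDeriv isOpen_ball hf) hmem
  have hT : ContinuousOnCircle (rotDeriv f) r :=
    .of_continuousOn (continuousOn_rotDeriv isOpen_ball hf) hmem
  have h1 := (hasSum_normSq_modeCoeff hE).add (hasSum_normSq_modeCoeff hT)
  have i1 : CircleIntegrable (fun z => ‖eulerDeriv f z‖ ^ 2) 0 r :=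
    (hE.norm.pow 2).intervalIntegrable _ _
  have i2 : CircleIntegrable (fun z => ‖rotDeriv f z‖ ^ 2) 0 r :=
    (hT.norm.pow 2).intervalIntegrable _ _
  rw [← circleAverage_fun_add i1 i2] at h1
  have h2 : circleAverage (fun z => ‖eulerDeriv f z‖ ^ 2 + ‖rotDeriv f z‖ ^ 2) 0 r
      = r ^ 2 * circleAverage (hilbertSchmidtSq f) 0 r := by
    rw [← smul_eq_mul, ← circleAverage_smul, circleAverage, circleAverage]
    congr 1
    refine intervalIntegral.integral_congr fun θ _ => ?_
    have := norm_sq_clm_apply_add (fderiv ℝ f (circleMap 0 r θ)) (circleMap 0 r θ)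
    simpa [eulerDeriv, rotDeriv, hilbertSchmidtSq] using this
  rw [h2] at h1
  have h3 := h1.mul_left r⁻¹
  have hr0 := hr.1.ne'
  have h4 : r⁻¹ * (r ^ 2 * circleAverage (hilbertSchmidtSq f) 0 r)
      = r * circleAverage (hilbertSchmidtSq f) 0 r := by field_simp
  rw [h4] at h3
  refine h3.congr_fun fun n => ?_
  obtain ⟨hm, he⟩ := modeCoeff_of_harmonicOnNhd_ball hf hc n
  have ht : modeCoeff (rotDeriv f) r n = Complex.I * n * modeCoeff f r n :=
    modeCoeff_fderivWithin_rot hmem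
      (fun z hz => (HarmonicOnNhd.hasFDerivAt hf hz).hasFDerivWithinAt) hL n
  rw [he r hr.1 hr.2, ht, hm r hr.1 hr.2.le]
  have hn : ‖(n : ℂ)‖ = n.natAbs := by
    rw [Complex.norm_intCast, Nat.cast_natAbs, Int.cast_abs]
  simp only [norm_mul, norm_pow, Complex.norm_I, Complex.norm_natCast, hn,
    Complex.norm_of_nonneg hr.1.le, one_mul]
  -- The exponent 2|n| - 1 is truncated at n = 0, harmlessly, since the coefficient vanishes there.
  rcases Nat.eq_zero_or_pos n.natAbs with h0 | h0
  · simp [h0]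
  · obtain ⟨k, hk⟩ := Nat.exists_eq_add_of_le' h0
    rw [hk, show 2 * (k + 1) - 1 = 2 * k + 1 by omega]
    field_simp
    ring

/-- Integrate the circle averages termwise: 2n²r^(2|n|-1) has integral |n| on [0, 1]. The dominating
series Σ 2n²|c_n|² converges because the radial derivative of `f` is continuous on the unit circle,
hence square-summable in modes. -/
theorem hasSum_integral_hilbertSchmidtSq {f : ℂ → ℂ} (hf : HarmonicOnNhd f (ball 0 1))
    (hC1 : ContDiffOn ℝ 1 f (closedBall 0 1)) :
    HasSum (fun n : ℤ => n.natAbs * ‖modeCoeff f 1 n‖ ^ 2)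
      ((2 * π)⁻¹ * ∫ z in ball (0 : ℂ) 1, hilbertSchmidtSq f z) := by
  have hL := hC1.continuousOn_fderivWithin uniqueDiffOn_closedBall le_rfl
  have hLo := continuousOn_fderiv_of_harmonicOnNhd isOpen_ball hf
  obtain ⟨C, hC⟩ := (isCompact_closedBall (0 : ℂ) 1).exists_bound_of_continuousOn
    (f := fun z => ‖fderivWithin ℝ f (closedBall 0 1) z 1‖ ^ 2 +
      ‖fderivWithin ℝ f (closedBall 0 1) z Complex.I‖ ^ 2)
    (((hL.clm_apply continuousOn_const).norm.pow 2).add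
      ((hL.clm_apply continuousOn_const).norm.pow 2))
  have hpi := pi_pos
  have harea := setIntegral_ball_eq_circleAverage (g := hilbertSchmidtSq f) (C := C)
    (((hLo.clm_apply continuousOn_const).norm.pow 2).add
      ((hLo.clm_apply continuousOn_const).norm.pow 2))
    (fun z hz => by
      have := hC z (ball_subset_closedBall hz)
      rwa [fderivWithin_closedBall_eq hz] at this)
  rw [harea, inv_mul_cancel_left₀ (by positivity)]
  have hsum : Summable fun n : ℤ => 2 * (n.natAbs * ‖modeCoeff f 1 n‖) ^ 2 := by
    have hE : ContinuousOnCircle (fun z => fderivWithin ℝ f (closedBall 0 1) z z) 1 :=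
      .of_continuousOn (hL.clm_apply continuousOn_id)
        fun θ => circleMap_zero_mem_closedBall ⟨zero_le_one, le_rfl⟩ θ
    refine ((hasSum_normSq_modeCoeff hE).summable.mul_left 2).congr fun n => ?_
    rw [modeCoeff_radial_of_harmonicOnNhd_ball hf hC1, norm_mul, Complex.norm_natCast]
  have key := intervalIntegral.hasSum_integral_of_dominated_convergence (μ := volume)
    (a := 0) (b := 1)
    (F := fun (n : ℤ) (r : ℝ) =>
      2 * (n.natAbs * ‖modeCoeff f 1 n‖) ^ 2 * r ^ (2 * n.natAbs - 1))
    (f := fun r => r * circleAverage (hilbertSchmidtSq f) 0 r)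
    (fun n _ => 2 * (n.natAbs * ‖modeCoeff f 1 n‖) ^ 2)
    (fun n => (by fun_prop : Continuous _).aestronglyMeasurable)
    (fun n => Filter.Eventually.of_forall fun r hr => by
      rw [uIoc_of_le zero_le_one] at hr
      have := hr.1.le
      rw [Real.norm_of_nonneg (by positivity)]
      exact mul_le_of_le_one_right (by positivity) (pow_le_one₀ hr.1.le hr.2))
    (Filter.Eventually.of_forall fun r _ => hsum) intervalIntegrable_const
    (by
      have h1 : ∀ᵐ r : ℝ ∂volume, r ≠ 1 := by simp [ae_iff, measure_singleton]
      filter_upwards [h1] with r hr1 hr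
      rw [uIoc_of_le zero_le_one] at hr
      exact hasSum_circleAverage_hilbertSchmidtSq hf hC1.continuousOn
        ⟨hr.1, lt_of_le_of_ne hr.2 hr1⟩)
  refine key.congr_fun fun n => ?_
  rw [intervalIntegral.integral_const_mul, integral_pow]
  rcases Nat.eq_zero_or_pos n.natAbs with h0 | h0
  · simp [h0]
  · obtain ⟨k, hk⟩ := Nat.exists_eq_add_of_le' h0
    rw [hk, show 2 * (k + 1) - 1 = 2 * k + 1 by omega]
    push_cast
    field_simp
    ring

/-! ### The inequality for each mode. -/

theorem quadratic_form_nonneg {A B S : ℝ} (hS : 0 < S) (hAB : B ^ 2 ≤ A * S ^ 2) (c e : ℂ) :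
    0 ≤ A * ‖c‖ ^ 2 + 2 * B * (starRingEnd ℂ c * e).re + S ^ 2 * ‖e‖ ^ 2 := by
  have h1 : S ^ 2 * (A * ‖c‖ ^ 2 + 2 * B * (starRingEnd ℂ c * e).re + S ^ 2 * ‖e‖ ^ 2)
      = (A * S ^ 2 - B ^ 2) * ‖c‖ ^ 2 + ((S ^ 2 * e.re + B * c.re) ^ 2
        + (S ^ 2 * e.im + B * c.im) ^ 2) := by
    simp only [Complex.sq_norm, Complex.normSq_apply, Complex.mul_re, Complex.conj_re,
      Complex.conj_im]
    ring
  refine nonneg_of_mul_nonneg_right (b := _) (a := S ^ 2) ?_ (by positivity)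
  rw [h1]
  have : 0 ≤ A * S ^ 2 - B ^ 2 := by linarith
  positivity

/-- Twice the difference of the two sides is (ρ - ρ⁻¹)ρ^(-m). -/
theorem mul_sinh_pow_le {ρ : ℝ} (hρ : 1 ≤ ρ) (m : ℕ) :
    ρ * ((ρ ^ m - (ρ ^ m)⁻¹) / 2) ≤ (ρ ^ (m + 1) - (ρ ^ (m + 1))⁻¹) / 2 := by
  have h0 : 0 < ρ := by linarith
  have h1 : (ρ ^ (m + 1))⁻¹ ≤ ρ * (ρ ^ m)⁻¹ := by
    rw [pow_succ, mul_inv, mul_comm]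
    have : ρ⁻¹ ≤ ρ := (inv_le_one_of_one_le₀ hρ).trans hρ
    gcongr
  have h2 : ρ ^ (m + 1) = ρ * ρ ^ m := by ring
  linarith

/-- Induction from m = 2: one step multiplies the base on the left by at most ((m+1)/m)² ≤ 9/4,
while S grows by a factor of at least ρ. The bound fails for m = 1. -/
theorem sq_le_mul_sinh_sq {ρ : ℝ} (hρ : 1 ≤ ρ) (ht : 7 ≤ ρ ^ 2) {m : ℕ} (hm : 2 ≤ m) :
    (m + (ρ ^ 2 - 4 - (ρ ^ 2)⁻¹) * m ^ 2 / 4) ^ 2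
      ≤ m * (ρ ^ 2 / 4 - 1 / 2 - 3 / 4 * (ρ ^ 2)⁻¹) * ((ρ ^ m - (ρ ^ m)⁻¹) / 2) ^ 2 := by
  set t := ρ ^ 2 with htd
  have hti : t⁻¹ ≤ 1 / 7 := by
    rw [inv_le_comm₀ (by linarith) (by norm_num)]; linarith
  have hti0 : 0 < t⁻¹ := by positivity
  have hK : 0 ≤ t - 4 - t⁻¹ := by linarith
  have hκ : 0 ≤ t / 4 - 1 / 2 - 3 / 4 * t⁻¹ := by linarith
  induction m, hm using Nat.le_induction with
  | base =>
    rw [← htd]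
    -- For m = 2 the base on the left is y - 2 and S = y/2, which leaves a cubic inequality in y ≥ 7
    -- - 1/7.
    set y := t - t⁻¹ with hy
    have hy1 : 48 / 7 ≤ y := by linarith
    have h1 : y / 4 - 4 / 7 ≤ t / 4 - 1 / 2 - 3 / 4 * t⁻¹ := by linarith
    have h2 : (y - 2) ^ 2 ≤ 2 * (y / 4 - 4 / 7) * (y / 2) ^ 2 := by
      nlinarith [mul_nonneg (sub_nonneg.2 hy1) (sq_nonneg y), sq_nonneg (y - 48 / 7)]
    push_cast
    calc (2 + (t - 4 - t⁻¹) * 2 ^ 2 / 4) ^ 2 = (y - 2) ^ 2 := by rw [hy]; ring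
      _ ≤ 2 * (y / 4 - 4 / 7) * (y / 2) ^ 2 := h2
      _ ≤ _ := by gcongr
  | succ m hm ih =>
    have hmR : (2 : ℝ) ≤ m := by exact_mod_cast hm
    have hp1 : 1 ≤ ρ ^ m := one_le_pow₀ hρ
    have hS0 : 0 ≤ (ρ ^ m - (ρ ^ m)⁻¹) / 2 := by
      have := inv_le_one_of_one_le₀ hp1
      linarith
    have hS := mul_sinh_pow_le hρ m
    set S := (ρ ^ m - (ρ ^ m)⁻¹) / 2
    set S' := (ρ ^ (m + 1) - (ρ ^ (m + 1))⁻¹) / 2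
    set X := (m : ℝ) + (t - 4 - t⁻¹) * m ^ 2 / 4
    have hX0 : 0 ≤ X := by positivity
    have hX : ((m + 1 : ℕ) : ℝ) + (t - 4 - t⁻¹) * ((m + 1 : ℕ) : ℝ) ^ 2 / 4 ≤ 9 / 4 * X := by
      push_cast
      have h1 : ((m : ℝ) + 1) ^ 2 ≤ 9 / 4 * m ^ 2 := by nlinarith
      have h2 := mul_le_mul_of_nonneg_left h1 hK
      have h3 : 9 / 4 * X = 9 / 4 * m + (t - 4 - t⁻¹) * (9 / 4 * (m : ℝ) ^ 2) / 4 := by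
        simp only [X]; ring
      rw [h3]
      linarith
    have hS2 : t * S ^ 2 ≤ S' ^ 2 := by
      rw [htd, ← mul_pow]
      exact pow_le_pow_left₀ (by positivity) hS 2
    calc (((m + 1 : ℕ) : ℝ) + (t - 4 - t⁻¹) * ((m + 1 : ℕ) : ℝ) ^ 2 / 4) ^ 2
        ≤ (9 / 4 * X) ^ 2 := pow_le_pow_left₀ (by positivity) hX 2
      -- (9/4)² = 81/16 is below 7.
      _ ≤ t * X ^ 2 := by nlinarith [sq_nonneg X]
      _ ≤ t * (m * (t / 4 - 1 / 2 - 3 / 4 * t⁻¹) * S ^ 2) := by gcongr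
      _ = m * (t / 4 - 1 / 2 - 3 / 4 * t⁻¹) * (t * S ^ 2) := by ring
      _ ≤ m * (t / 4 - 1 / 2 - 3 / 4 * t⁻¹) * S' ^ 2 := by gcongr
      _ ≤ ((m + 1 : ℕ) : ℝ) * (t / 4 - 1 / 2 - 3 / 4 * t⁻¹) * S' ^ 2 := by
          gcongr; exact Nat.le_succ m

/-- The quantity equals (1 - ρ^(-2k))/2. -/
theorem cosh_mul_sinh_sub_sq_bounds {ρ : ℝ} (hρ : 1 ≤ ρ) (k : ℕ) :
    0 ≤ (ρ ^ k + (ρ ^ k)⁻¹) / 2 * ((ρ ^ k - (ρ ^ k)⁻¹) / 2) - ((ρ ^ k - (ρ ^ k)⁻¹) / 2) ^ 2 ∧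
    (ρ ^ k + (ρ ^ k)⁻¹) / 2 * ((ρ ^ k - (ρ ^ k)⁻¹) / 2) - ((ρ ^ k - (ρ ^ k)⁻¹) / 2) ^ 2 ≤ 1 / 2 := by
  have hp1 : 1 ≤ ρ ^ k := one_le_pow₀ hρ
  have hpi := inv_le_one_of_one_le₀ hp1
  have hp0 : 0 < (ρ ^ k)⁻¹ := inv_pos.2 (one_pos.trans_le hp1)
  have hmul : ρ ^ k * (ρ ^ k)⁻¹ = 1 := mul_inv_cancel₀ (one_pos.trans_le hp1).ne'
  set p := ρ ^ k
  set q := p⁻¹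
  constructor <;> nlinarith

theorem pos_mode_coeff_ineq {ρ : ℝ} (hρ : 1 ≤ ρ) (ht : 7 ≤ ρ ^ 2) {m : ℕ} (hm : 1 ≤ m)
    {C S C₁ K : ℝ} (hC : C = (ρ ^ m + (ρ ^ m)⁻¹) / 2) (hS : S = (ρ ^ m - (ρ ^ m)⁻¹) / 2)
    (hC₁ : C₁ = (ρ + ρ⁻¹) / 2) (hK : K = ρ ^ 2 - 4 - (ρ ^ 2)⁻¹) :
    (C * S - m - K * m ^ 2 / 4) ^ 2
      ≤ (C ^ 2 - C₁ ^ 2 * m - K / 2 * (m * m - m)) * S ^ 2 := by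
  have hρ0 : ρ ≠ 0 := by linarith
  rcases hm.eq_or_lt with rfl | hm2
  · refine le_of_eq ?_
    subst hC hS hC₁ hK
    push_cast
    field_simp
    ring
  · have key := sq_le_mul_sinh_sq hρ ht (m := m) hm2
    obtain ⟨h3, -⟩ := cosh_mul_sinh_sub_sq_bounds hρ m
    rw [← hC, ← hS] at h3
    rw [← hS, ← hK] at key
    have hmR : (0 : ℝ) ≤ m := Nat.cast_nonneg m
    have hti : (ρ ^ 2)⁻¹ ≤ 1 / 7 := by
      rw [inv_le_comm₀ (by linarith) (by norm_num)]; linarith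
    have hK0 : 0 ≤ K := by linarith
    have hC₁' : C₁ ^ 2 = (K + 6 + 2 * (ρ ^ 2)⁻¹) / 4 := by
      rw [hC₁, hK]; field_simp; ring
    have hκ : ρ ^ 2 / 4 - 1 / 2 - 3 / 4 * (ρ ^ 2)⁻¹ = K / 4 + 1 / 2 - (ρ ^ 2)⁻¹ / 2 := by
      rw [hK]; ring
    rw [hκ] at key
    rw [hC₁']
    -- With X = m + Km²/4 the claim is X² + (C₁²m + K(m² - m)/2)S² ≤ 2CSX. Replacing CS by the
    -- smaller S² reduces it to `key`.
    have h4 := mul_nonneg (by positivity : 0 ≤ m + K * (m : ℝ) ^ 2 / 4) h3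
    linarith

theorem neg_mode_coeff_ineq {ρ : ℝ} (hρ : 1 ≤ ρ) (ht : 7 ≤ ρ ^ 2) {m : ℕ} (hm : 1 ≤ m)
    {C S C₁ K : ℝ} (hC : C = (ρ ^ m + (ρ ^ m)⁻¹) / 2) (hS : S = (ρ ^ m - (ρ ^ m)⁻¹) / 2)
    (hC₁ : C₁ = (ρ + ρ⁻¹) / 2) (hK : K = ρ ^ 2 - 4 - (ρ ^ 2)⁻¹) :
    (C * S - m + K * m ^ 2 / 4) ^ 2
      ≤ (C ^ 2 + C₁ ^ 2 * m + K / 2 * (m * m + m)) * S ^ 2 := by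
  have hρ0 : ρ ≠ 0 := by linarith
  have hti : (ρ ^ 2)⁻¹ ≤ 1 / 7 := by
    rw [inv_le_comm₀ (by linarith) (by norm_num)]; linarith
  have hti0 : 0 < (ρ ^ 2)⁻¹ := by positivity
  have hK0 : 0 ≤ K := by linarith
  have hC₁' : C₁ ^ 2 = (K + 6 + 2 * (ρ ^ 2)⁻¹) / 4 := by
    rw [hC₁, hK]; field_simp; ring
  obtain ⟨h3, h4⟩ := cosh_mul_sinh_sub_sq_bounds hρ m
  rw [← hC, ← hS] at h3 h4
  set X : ℝ := m + K * (m : ℝ) ^ 2 / 4 with hX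
  set Y : ℝ := K * (m : ℝ) ^ 2 / 4 - m with hY
  have hmR : (1 : ℝ) ≤ m := by exact_mod_cast hm
  have hX1 : 1 ≤ X := by
    have : 0 ≤ K * (m : ℝ) ^ 2 / 4 := by positivity
    linarith
  have hYX : Y ≤ X := by linarith
  have hYX2 : Y ^ 2 ≤ X ^ 2 := by
    have h5 : 0 ≤ K * (m : ℝ) ^ 2 / 4 := by positivity
    nlinarith
  have hcross : 2 * (C * S - S ^ 2) * Y ≤ X := by
    nlinarith
  -- After cancelling C²S² and moving 2S²Y to the left, the claim is 2(CS - S²)Y + Y² ≤ m(2 + C₁² +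
  -- K/2)S², whose left side is at most X + X² ≤ 2X². The case m = 1 is computed by hand because
  -- `sq_le_mul_sinh_sq` starts at 2.
  have main : X + X ^ 2 ≤ m * (2 + C₁ ^ 2 + K / 2) * S ^ 2 := by
    rcases hm.eq_or_lt with rfl | hm2
    · have hS2 : S ^ 2 = (ρ ^ 2 - 2 + (ρ ^ 2)⁻¹) / 4 := by
        rw [hS]; field_simp; ring
      have hXt : X = (ρ ^ 2 - (ρ ^ 2)⁻¹) / 4 := by rw [hX, hK]; push_cast; ring
      rw [hS2, hC₁', hXt, hK]
      push_cast
      nlinarith [mul_nonneg (sub_nonneg.2 ht) hti0.le]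
    · have key := sq_le_mul_sinh_sq hρ ht (m := m) hm2
      rw [← hS, ← hK, ← hX] at key
      have hlam : 2 * (ρ ^ 2 / 4 - 1 / 2 - 3 / 4 * (ρ ^ 2)⁻¹) ≤ 2 + C₁ ^ 2 + K / 2 := by
        rw [hC₁']
        linarith
      have : 2 * (m * (ρ ^ 2 / 4 - 1 / 2 - 3 / 4 * (ρ ^ 2)⁻¹) * S ^ 2)
          ≤ m * (2 + C₁ ^ 2 + K / 2) * S ^ 2 := by
        calc _ = m * (2 * (ρ ^ 2 / 4 - 1 / 2 - 3 / 4 * (ρ ^ 2)⁻¹)) * S ^ 2 := by ring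
          _ ≤ _ := by gcongr
      nlinarith
  have e1 : (C * S - m + K * m ^ 2 / 4) ^ 2 = (C * S + Y) ^ 2 := by rw [hY]; ring
  have e2 : (C ^ 2 + C₁ ^ 2 * m + K / 2 * (m * m + m)) * S ^ 2
      = C ^ 2 * S ^ 2 + S ^ 2 * (2 * Y) + m * (2 + C₁ ^ 2 + K / 2) * S ^ 2 := by rw [hY]; ring
  rw [e1, e2]
  nlinarith

theorem half_le_log_of_seven_le_sq {ρ : ℝ} (ht : 7 ≤ ρ ^ 2) : 1 / 2 ≤ Real.log ρ := by
  have h1 : 1 ≤ Real.log (ρ ^ 2) := by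
    rw [Real.le_log_iff_exp_le (by linarith)]
    linarith [Real.exp_one_lt_three]
  rw [Real.log_pow] at h1
  push_cast at h1
  linarith

/-- The contribution of each Fourier mode is nonnegative. -/
theorem mode_contribution_nonneg {ρ : ℝ} (hρ : 1 ≤ ρ) (ht : 7 ≤ ρ ^ 2) (n : ℤ) (c d : ℂ) :
    0 ≤ ‖(c + d / n.natAbs) / 2 * (ρ : ℂ) ^ n.natAbs
          + (c - d / n.natAbs) / 2 * ((ρ : ℂ) ^ n.natAbs)⁻¹
          + if n = 0 then d * Real.log ρ else 0‖ ^ 2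
      - ((ρ + ρ⁻¹) / 2) ^ 2 * (n * ‖c‖ ^ 2)
      - 2 * (starRingEnd ℂ c * d).re
      - (ρ ^ 2 - 4 - (ρ ^ 2)⁻¹) / 2 * (n * (starRingEnd ℂ c * d).re)
      - (ρ ^ 2 - 4 - (ρ ^ 2)⁻¹) / 2 * (n * (n.natAbs * ‖c‖ ^ 2) - n.natAbs * ‖c‖ ^ 2) := by
  rcases eq_or_ne n 0 with rfl | hn
  · have hL := half_le_log_of_seven_le_sq ht
    -- The mode n = 0 is c + d log ρ at radius ρ, and (log ρ - 1)² ≤ (log ρ)² amounts to log ρ ≥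
    -- 1/2.
    have h := quadratic_form_nonneg (A := 1) (B := Real.log ρ - 1) (S := Real.log ρ)
      (by linarith) (by nlinarith) c d
    have hM : ‖(c + d / (Int.natAbs 0 : ℕ)) / 2 * (ρ : ℂ) ^ (Int.natAbs 0)
        + (c - d / (Int.natAbs 0 : ℕ)) / 2 * ((ρ : ℂ) ^ (Int.natAbs 0))⁻¹
        + if (0 : ℤ) = 0 then d * Real.log ρ else 0‖ ^ 2
        = ‖c‖ ^ 2 + 2 * Real.log ρ * (starRingEnd ℂ c * d).re
          + Real.log ρ ^ 2 * ‖d‖ ^ 2 := by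
      simp only [Int.natAbs_zero, Nat.cast_zero, div_zero, add_zero, sub_zero, pow_zero, inv_one,
        mul_one, add_halves, if_true, Complex.sq_norm, Complex.normSq_apply]
      simp
      ring
    rw [hM]
    simp only [Int.natAbs_zero, Nat.cast_zero, Int.cast_zero, zero_mul, mul_zero, sub_zero]
    linarith
  · obtain ⟨k, hk⟩ : ∃ k : ℕ, n.natAbs = k := ⟨_, rfl⟩
    have hk1 : 1 ≤ k := by omega
    have hkC : (k : ℂ) ≠ 0 := by exact_mod_cast (by omega : k ≠ 0)
    have hkR : (k : ℝ) ≠ 0 := by exact_mod_cast (by omega : k ≠ 0)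
    rw [hk, if_neg hn]
    set e : ℂ := d / k with he
    have hd : d = k * e := by rw [he]; field_simp
    set C : ℝ := (ρ ^ k + (ρ ^ k)⁻¹) / 2 with hC
    set S : ℝ := (ρ ^ k - (ρ ^ k)⁻¹) / 2 with hS
    have hre : (starRingEnd ℂ c * d).re = k * (starRingEnd ℂ c * e).re := by
      rw [hd]; simp; ring
    have hM : ‖(c + e) / 2 * (ρ : ℂ) ^ k + (c - e) / 2 * ((ρ : ℂ) ^ k)⁻¹ + 0‖ ^ 2
        = C ^ 2 * ‖c‖ ^ 2 + 2 * (C * S) * (starRingEnd ℂ c * e).re + S ^ 2 * ‖e‖ ^ 2 := by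
      have : (c + e) / 2 * (ρ : ℂ) ^ k + (c - e) / 2 * ((ρ : ℂ) ^ k)⁻¹ + 0
          = (C : ℂ) * c + (S : ℂ) * e := by
        rw [hC, hS]; push_cast; ring
      rw [this]
      simp only [Complex.sq_norm, Complex.normSq_apply]
      simp
      ring
    have hS0 : 0 < S := by
      have h7 : 1 < ρ := by nlinarith
      have h8 : 1 < ρ ^ k := one_lt_pow₀ h7 (by omega)
      have h9 := inv_lt_one_of_one_lt₀ h8
      rw [hS]; linarith
    rw [hM, hre]
    rcases Int.natAbs_eq n with h | h
    · rw [hk] at h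
      rw [h]
      have := quadratic_form_nonneg hS0 (pos_mode_coeff_ineq hρ ht hk1 hC hS rfl rfl) c e
      push_cast
      linarith
    · rw [hk] at h
      rw [h]
      have := quadratic_form_nonneg hS0 (neg_mode_coeff_ineq hρ ht hk1 hC hS rfl rfl) c e
      push_cast
      linarith

/-! ### Boundary derivatives of the data and summation over the modes. -/

theorem angularDeriv_circleMap {h : ℂ → ℂ} {L : ℂ →L[ℝ] ℂ} {s : Set ℂ} {r θ : ℝ}
    (hs : ∀ θ : ℝ, circleMap 0 r θ ∈ s) (hF : HasFDerivWithinAt h L s (circleMap 0 r θ)) :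
    angularDeriv h (circleMap 0 r θ) = L (Complex.I * circleMap 0 r θ) := by
  have h1 := hasDerivAt_comp_circleMap hs hF
  rw [← add_zero θ] at h1
  have h2 := h1.comp_const_add θ 0
  rw [add_zero] at h2
  rw [angularDeriv, ← h2.deriv]
  congr 1
  funext t
  simp only [circleMap, zero_add]
  rw [mul_assoc, ← Complex.exp_add]
  push_cast
  ring_nf

theorem norm_mul_normRadialDeriv {h : ℂ → ℂ} {L : ℂ →L[ℝ] ℂ} {R : ℝ} (hR : 1 < R) {z : ℂ}
    (hz : ‖z‖ = 1) (hF : HasFDerivWithinAt h L (annulusInnerClosed 1 R) z) :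
    ‖h z‖ * normRadialDeriv h z = (starRingEnd ℂ (h z) * L z).re := by
  -- At a zero of `h` the modulus need not be differentiable, but the factor ‖h z‖ makes both sides
  -- 0. Elsewhere the square root of ‖h‖² can be differentiated.
  by_cases h0 : h z = 0
  · simp [h0]
  have hray : HasDerivWithinAt (fun r : ℝ => (r : ℂ) * (z / ‖z‖)) z (Ico 1 R) 1 := by
    have := ((Complex.ofRealCLM.hasDerivAt (x := 1)).mul_const (z / ‖z‖))
    simpa [hz] using this.hasDerivWithinAt
  have h1 : HasDerivWithinAt (fun r : ℝ => h (r * (z / ‖z‖))) (L z) (Ico 1 R) 1 := by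
    refine HasFDerivWithinAt.comp_hasDerivWithinAt_of_eq 1 hF hray (fun r hr => ?_) (by simp [hz])
    have : ‖(r : ℂ) * (z / ‖z‖)‖ = r := by
      simp [hz, abs_of_nonneg (zero_le_one.trans hr.1)]
    exact ⟨by rw [this]; exact hr.1, by rw [this]; exact hr.2⟩
  have h2 : HasDerivWithinAt (fun r : ℝ => h (r * (z / ‖z‖))) (L z) (Ici 1) 1 :=
    h1.mono_of_mem_nhdsWithin (Ico_mem_nhdsGE hR)
  have hone : h ((1 : ℝ) * (z / ‖z‖)) = h z := by simp [hz]
  have h3 := h2.norm_sq.sqrt (by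
    rw [hone]
    exact pow_ne_zero 2 (norm_ne_zero_iff.2 h0))
  simp only [Real.sqrt_sq (norm_nonneg _), hone] at h3
  rw [normRadialDeriv, hz]
  simp only [hz] at h3
  rw [h3.derivWithin (uniqueDiffOn_Ici 1 1 self_mem_Ici)]
  have hn : ‖h z‖ ≠ 0 := norm_ne_zero_iff.2 h0
  rw [Complex.inner]
  field_simp

theorem proposition5p1 (R : ℝ) (hR : 1 < R) (h f : ℂ → ℂ)
    (hharm : HarmonicOnNhd h (annulus 1 R))
    (hC1 : ContDiffOn ℝ 1 h (annulusInnerClosed 1 R))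
    (hf : IsHarmonicExtension h f) :
    ContDiffOn ℝ 1 f (closedBall 0 1) ∧
    ∀ ρ : ℝ, √7 ≤ ρ → ρ < R →
      0 ≤ circleAverage (fun z => ‖h z‖ ^ 2) 0 ρ
        - ((ρ + ρ⁻¹) / 2) ^ 2
            * circleAverage (fun z => (starRingEnd ℂ (h z) * angularDeriv h z).im) 0 1
        - 2 * circleAverage (fun z => ‖h z‖ * normRadialDeriv h z) 0 1
        - (ρ ^ 2 - 4 - (ρ ^ 2)⁻¹) / 2
            * circleAverage (jacobianWithin h (annulusInnerClosed 1 R)) 0 1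
        - (ρ ^ 2 - 4 - (ρ ^ 2)⁻¹) / (4 * π)
            * ((∫ θ in (0 : ℝ)..(2 * π), jacobianWithin f (closedBall 0 1) (circleMap 0 1 θ))
                - ∫ z in ball (0 : ℂ) 1, hilbertSchmidtSq f z) := by
  have hfC1 := hf.contDiffOn_closedBall hR hharm hC1
  refine ⟨hfC1, fun ρ hρ hρR => ?_⟩
  have ht : 7 ≤ ρ ^ 2 := by
    have := pow_le_pow_left₀ (Real.sqrt_nonneg 7) hρ 2
    rwa [Real.sq_sqrt (by norm_num)] at this
  have hρ1 : 1 ≤ ρ := by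
    refine le_trans ?_ hρ
    rw [Real.one_le_sqrt]
    norm_num
  have hmem : ∀ r ∈ Ico (1 : ℝ) R, ∀ θ : ℝ, circleMap 0 r θ ∈ annulusInnerClosed 1 R :=
    fun r hr => circleMap_zero_mem_annulusInnerClosed zero_le_one hr
  have h1R : (1 : ℝ) ∈ Ico 1 R := left_mem_Ico.2 hR
  have hρm : ρ ∈ Ico 1 R := ⟨hρ1, hρR⟩
  set L := fderivWithin ℝ h (annulusInnerClosed 1 R) with hLdef
  have hu := uniqueDiffOn_annulusInnerClosed (a := 1) (b := R) one_pos
  have hL : ContinuousOn L (annulusInnerClosed 1 R) := hC1.continuousOn_fderivWithin hu le_rfl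
  have hd : ∀ z ∈ annulusInnerClosed 1 R, HasFDerivWithinAt h (L z) (annulusInnerClosed 1 R) z :=
    fun z hz => (hC1.differentiableOn one_ne_zero z hz).hasFDerivWithinAt
  have hh1 : ContinuousOnCircle h 1 := .of_continuousOn hC1.continuousOn (hmem 1 h1R)
  have hhρ : ContinuousOnCircle h ρ := .of_continuousOn hC1.continuousOn (hmem ρ hρm)
  have hE : ContinuousOnCircle (fun z => L z z) 1 :=
    .of_continuousOn (hL.clm_apply continuousOn_id) (hmem 1 h1R)
  have hT : ContinuousOnCircle (fun z => L z (Complex.I * z)) 1 :=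
    .of_continuousOn (hL.clm_apply (by fun_prop)) (hmem 1 h1R)
  set c : ℤ → ℂ := fun n => modeCoeff h 1 n with hc
  set d : ℤ → ℂ := fun n => modeCoeff (fun z => L z z) 1 n with hddef
  have H1 := hasSum_normSq_modeCoeff hhρ
  simp only [fun n => modeCoeff_of_harmonicOnNhd_annulus hR hharm hC1 n (c := c n) (d := d n)
    rfl rfl hρm] at H1
  have H2 : HasSum (fun n : ℤ => (n : ℝ) * ‖c n‖ ^ 2)
      (circleAverage (fun z => (starRingEnd ℂ (h z) * angularDeriv h z).im) 0 1) := by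
    -- Im(h̄ h_θ) = Re(h̄ · (-i h_θ)), and -i h_θ has coefficients n c_n.
    have := hasSum_re_conj_mul_modeCoeff hh1 (hE.linear hT 0 (-Complex.I))
    convert this using 1
    · funext n
      rw [modeCoeff_linear hE hT, modeCoeff_fderivWithin_rot (hmem 1 h1R) hd hL]
      simp only [hc, Complex.sq_norm, Complex.normSq_apply]
      simp
      ring
    · rw [circleAverage, circleAverage]
      congr 1
      refine intervalIntegral.integral_congr fun θ _ => ?_
      rw [angularDeriv_circleMap (hmem 1 h1R) (hd _ (hmem 1 h1R θ))]
      simp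
      ring
  have H3 : HasSum (fun n : ℤ => (starRingEnd ℂ (c n) * d n).re)
      (circleAverage (fun z => ‖h z‖ * normRadialDeriv h z) 0 1) := by
    convert hasSum_re_conj_mul_modeCoeff hh1 hE using 1
    rw [circleAverage, circleAverage]
    congr 1
    refine intervalIntegral.integral_congr fun θ _ => ?_
    exact norm_mul_normRadialDeriv hR (by simp) (hd _ (hmem 1 h1R θ))
  have H4 := hasSum_jacobianWithin hu hC1 (hmem 1 h1R)
  have hcf : ∀ n, modeCoeff f 1 n = c n :=
    modeCoeff_congr fun θ => hf.eqOn (circleMap_mem_sphere 0 zero_le_one θ)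
  have H5 : HasSum (fun n : ℤ => (n : ℝ) * (n.natAbs * ‖c n‖ ^ 2))
      (circleAverage (jacobianWithin f (closedBall 0 1)) 0 1) := by
    refine (hasSum_jacobianWithin uniqueDiffOn_closedBall hfC1
      fun θ => circleMap_zero_mem_closedBall ⟨zero_le_one, le_rfl⟩ θ).congr_fun fun n => ?_
    rw [modeCoeff_radial_of_harmonicOnNhd_ball hf.harmonic hfC1, hcf, Complex.sq_norm,
      Complex.normSq_apply]
    simp only [Complex.mul_re, Complex.mul_im, Complex.conj_re, Complex.conj_im,
      Complex.natCast_re, Complex.natCast_im]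
    ring
  have H6 := hasSum_integral_hilbertSchmidtSq hf.harmonic hfC1
  simp only [hcf] at H6
  have hint : (∫ θ in (0 : ℝ)..(2 * π), jacobianWithin f (closedBall 0 1) (circleMap 0 1 θ))
      = 2 * π * circleAverage (jacobianWithin f (closedBall 0 1)) 0 1 := by
    rw [circleAverage, smul_eq_mul, mul_inv_cancel_left₀ two_pi_pos.ne']
  have htot := (((H1.sub (H2.mul_left (((ρ + ρ⁻¹) / 2) ^ 2))).sub (H3.mul_left 2)).sub
    (H4.mul_left ((ρ ^ 2 - 4 - (ρ ^ 2)⁻¹) / 2))).sub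
    ((H5.sub H6).mul_left ((ρ ^ 2 - 4 - (ρ ^ 2)⁻¹) / 2))
  refine (htot.nonneg fun n => mode_contribution_nonneg hρ1 ht n (c n) (d n)).trans_eq ?_
  rw [hint]
  have := pi_pos
  field_simp
  ring
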